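/- A \emph{knot diagram} is a smooth immersion $k:\mathbb R/\mathbb Z\to\mathbb R^2$ (up to orientation-preserving reparametrization) whose only multiple points are finitely many transversal double points, with a choice of an overpassing and an underpassing strand at each double point. The sign of a crossing is the sign of $\det(\text{velocity of the overpass},\text{velocity of the underpass})$. The \emph{Gauss diagram} $G_k$ is the parametrizing circle with one signed arrow for each crossing, from the overpass to the underpass, carrying the sign of the crossing. The \emph{weirdness} $W_3(k)$ is the sum, over all sets of three arrows of $G_k$ that look like three diameters of the circle with heads and tails alternating along the circle, of the product of the three signs. An \emph{$\Omega_3$-move} with changing disk $C$ transforms a knot diagram $k$ into a knot diagram $l$ which is the same outside $C$. Inside $C$ each of the two diagrams consists of three pairwise crossing strands, which form a triangle: the \emph{top} strand passes over both others, the \emph{middle} strand over the bottom strand only, and the \emph{bottom} strand over none. The move pushes one of the strands across the crossing of the other two; that is, up to orientation-preserving diffeomorphisms from $C$ to the unit disk that agree on $\partial C$, it replaces the three strands $y=x$, $y=-x$, $y=\tfrac12(1-x^2)$ by $y=x$, $y=-x$, $y=-\tfrac12(1-x^2)$ with the same ends, directions and heights. The cyclic order in which the three strands are passed along the knot orients the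 triangle. Let $n$ be the number of edges of the triangle on which this orientation coincides with the orientation of the knot, and put $q=(-1)^n$. The move is \emph{positively directed} (in Arnold's sense) if $q=-1$ before and $q=+1$ after the move. The part of $k$ exterior to $C$ consists of three strands. Let $a$ be the one that connects the top with the middle strand inside $C$, and $b$ the one that connects the middle with the bottom strand. Erase the part of $k$ inside $C$ and the third exterior strand, and make $a$ and $b$ into the components $\hat a,\hat b$ of a two-component link diagram by connecting the two ends of each of them with a strand inside $C$, in such a way that the strand that closes $b$ does not pass over the strand that closes $a$ (the components may have corners; all crossings are transversal double points away from the corners). The \emph{local linking number} $llk(k,C)$ is the linking number of this link, that is, the sum of the signs of the crossings where $\hat b$ crosses over $\hat a$. \textbf{Proposition.} Let $k\mapsto l$ be a positively directed $\Omega_3$-move in the changing disk $C$. Then a link diagram as above exists, and for every such link diagram its linking number $llk(k,C)$ satisfies $$W_3(l)-W_3(k)=llk(k,C).$$ -/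

import Mathlib

open Set
open scoped ContDiff

noncomputable section

/-! ### Plane curves and diagrams -/

/-- The oriented Euclidean plane. -/
abbrev Plane : Type := EuclideanSpace ℝ (Fin 2)

/-- The determinant of the pair `(u, v)`; it is positive iff `(u, v)` is a positive basis. -/
def planeDet (u v : Plane) : ℝ := u 0 * v 1 - u 1 * v 0

/-- A family of closed plane curves, each parametrized by the oriented circle `ℝ / ℤ`. -/
structure ClosedCurves (ι : Type) where
  curve : ι → ℝ → Plane
  periodic : ∀ i, Function.Periodic (curve i) 1

namespace ClosedCurves

variable {ι : Type}

/-- The points of the parametrizing circles, one circle for each component. -/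
abbrev Pt (ι : Type) : Type := ι × UnitAddCircle

/-- The point with parameter `t` on the circle of the component `i`. -/
def pt (i : ι) (t : ℝ) : Pt ι := (i, (t : UnitAddCircle))

/-- The point of the plane to which a point of the parametrizing circles is mapped. -/
def eval (L : ClosedCurves ι) (p : Pt ι) : Plane := (L.periodic p.1).lift p.2

theorem eval_pt (L : ClosedCurves ι) (i : ι) (t : ℝ) : L.eval (pt i t) = L.curve i t :=
  (L.periodic i).lift_coe t

theorem periodic_deriv (L : ClosedCurves ι) (i : ι) :
    Function.Periodic (deriv (L.curve i)) 1 := by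
  intro t
  rw [← deriv_comp_add_const]
  congr 1
  funext s
  exact L.periodic i s

/-- The velocity vector at a point of the parametrizing circles. -/
def velocity (L : ClosedCurves ι) (p : Pt ι) : Plane := (L.periodic_deriv p.1).lift p.2

theorem velocity_pt (L : ClosedCurves ι) (i : ι) (t : ℝ) :
    L.velocity (pt i t) = deriv (L.curve i) t :=
  (L.periodic_deriv i).lift_coe t

/-- `p` and `q` are the two (distinct) preimages of a multiple point. -/
def Crosses (L : ClosedCurves ι) (p q : Pt ι) : Prop := p ≠ q ∧ L.eval p = L.eval q

/-- The component `i` is a smooth immersion near the parameter `t`. -/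
def RegularAt (L : ClosedCurves ι) (i : ι) (t : ℝ) : Prop :=
  ContDiffAt ℝ ∞ (L.curve i) t ∧ deriv (L.curve i) t ≠ 0

/-- The restriction of the component `i` to the closed interval `[s, t]` is a smooth immersion
(one-sided derivatives are used at the ends). -/
def RegularOn (L : ClosedCurves ι) (i : ι) (s t : ℝ) : Prop :=
  ContDiffOn ℝ ∞ (L.curve i) (Icc s t) ∧
    ∀ u ∈ Icc s t, derivWithin (L.curve i) (Icc s t) u ≠ 0

end ClosedCurves

open ClosedCurves

/-- An oriented link diagram with components indexed by `ι`: piecewise smooth immersed closed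
curves whose only multiple points are finitely many transversal double points, none of them at a
corner, together with the set `overpass` of the preimages of crossing points on the overpassing
strands. -/
structure LinkDiagram (ι : Type) extends ClosedCurves ι where
  piecewise_regular : ∀ i t, ∃ δ > 0,
    toClosedCurves.RegularOn i (t - δ) t ∧ toClosedCurves.RegularOn i t (t + δ)
  regular_of_crosses : ∀ i t q, toClosedCurves.Crosses (pt i t) q → toClosedCurves.RegularAt i t
  transversal : ∀ p q, toClosedCurves.Crosses p q →
    planeDet (toClosedCurves.velocity p) (toClosedCurves.velocity q) ≠ 0
  no_triple : ∀ p q r, toClosedCurves.Crosses p q → toClosedCurves.Crosses q r → p = r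
  finite_crossings :
    {x : Pt ι × Pt ι | toClosedCurves.Crosses x.1 x.2}.Finite
  overpass : Set (Pt ι)
  crosses_of_mem_overpass : ∀ p ∈ overpass, ∃ q, toClosedCurves.Crosses p q
  overpass_iff : ∀ p q, toClosedCurves.Crosses p q → (p ∈ overpass ↔ q ∉ overpass)

/-- An oriented knot diagram: a diagram with one component, which is a smooth immersion. -/
structure KnotDiagram extends LinkDiagram Unit where
  regular : ∀ t, toClosedCurves.RegularAt () t

/-- The parametrization of a knot diagram. -/
def KnotDiagram.path (k : KnotDiagram) (t : ℝ) : Plane := k.curve () t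

/-- The point with parameter `t` on the parametrizing circle of `k` is the preimage of a crossing,
on the overpassing strand. -/
def KnotDiagram.IsOver (k : KnotDiagram) (t : ℝ) : Prop := pt () t ∈ k.overpass

/-! ### Gauss diagrams, linking numbers and the weirdness -/

/-- A Gauss diagram on the circles indexed by `ι`: finitely many signed arrows, each given by the
pair of its tail and its head. -/
structure GaussDiagram (ι : Type) where
  arrows : Finset (Pt ι × Pt ι)
  sign : Pt ι × Pt ι → ℤ

/-- The Gauss diagram of a link diagram: one arrow for each crossing, which points from the
overpass to the underpass and has the sign of the crossing. -/
def LinkDiagram.gaussDiagram {ι : Type} (L : LinkDiagram ι) : GaussDiagram ι where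
  arrows := (L.finite_crossings.subset
    (t := {x : Pt ι × Pt ι | L.Crosses x.1 x.2 ∧ x.1 ∈ L.overpass}) (fun _ hx => hx.1)).toFinset
  sign x := SignType.sign (planeDet (L.velocity x.1) (L.velocity x.2))

open Classical in
/-- The linking number of the components `i` and `j` of a link diagram, computed from the component
`i`: the sum of the signs of the crossings where the component `i` crosses over the
component `j`. -/
def LinkDiagram.linkingNumber {ι : Type} (L : LinkDiagram ι) (i j : ι) : ℤ :=
  ∑ x ∈ L.gaussDiagram.arrows with x.1.1 = i ∧ x.2.1 = j, L.gaussDiagram.sign x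

/-- The arrows in `S` form the arrow diagram `w₃`: three diameters of the circle, directed so that
no two heads are adjacent. The ends of the arrows are met in the cyclic order `r 0, …, r 5`. -/
def IsW3 (S : Finset (Pt Unit × Pt Unit)) : Prop :=
  ∃ r : Fin 6 → ℝ, StrictMono r ∧ r 5 < r 0 + 1 ∧
    (S : Set (Pt Unit × Pt Unit)) =
      {(pt () (r 0), pt () (r 3)), (pt () (r 2), pt () (r 5)), (pt () (r 4), pt () (r 1))}

open Classical in
/-- The sum of the signs of the subdiagrams of the form `w₃`, where the sign of a subdiagram is the
product of the signs of its arrows. -/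
def GaussDiagram.w3 (G : GaussDiagram Unit) : ℤ :=
  ∑ S ∈ G.arrows.powerset with IsW3 S, ∏ x ∈ S, G.sign x

/-- The weirdness `W₃` of a knot diagram. -/
def KnotDiagram.weirdness (k : KnotDiagram) : ℤ := k.gaussDiagram.w3

/-! ### Moves of type `Ω₃` -/

/-- An orientation-preserving diffeomorphism (of neighbourhoods) that takes the set `C` to the
closed unit disk. -/
structure DiskChart (C : Set Plane) where
  toHomeo : OpenPartialHomeomorph Plane Plane
  subset_source : C ⊆ toHomeo.source
  image_eq : toHomeo '' C = Metric.closedBall 0 1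
  smooth : ContDiffOn ℝ ∞ toHomeo toHomeo.source
  smooth_symm : ContDiffOn ℝ ∞ toHomeo.symm toHomeo.target
  orientation : ∀ p ∈ toHomeo.source, 0 < (fderiv ℝ toHomeo p).det

/-- The standard picture of three strands in the unit disk: two diameters, and an arc that joins
the points `(-1, 0)` and `(1, 0)` and passes above (`ε = 1`) or below (`ε = -1`) the point where
the diameters cross. Passing from one picture to the other is the `Ω₃`-move. -/
def standardStrand (ε : ℝ) : Fin 3 → Set Plane :=
  ![{p ∈ Metric.closedBall 0 1 | p 1 = p 0},
    {p ∈ Metric.closedBall 0 1 | p 1 = -p 0},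
    {p ∈ Metric.closedBall 0 1 | p 1 = ε * (1 - p 0 ^ 2) / 2}]

/-- The part of the knot diagram `k` in the disk `C` looks like the standard picture of three
strands, of which one (the top strand) has two overcrossings, one (the middle strand) has one, and
one (the bottom strand) has none. The strands inside `C` are numbered in the cyclic order in which
they are passed when one moves along `k`. -/
structure ThreeStrands (k : KnotDiagram) (C : Set Plane) (ε : ℝ) where
  chart : DiskChart C
  /-- The parameters where the strands in `C` start. -/
  start : Fin 3 → ℝ
  /-- The parameters where the strands in `C` end. -/
  finish : Fin 3 → ℝ
  start_lt_finish : ∀ i, start i < finish i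
  finish_zero_lt : finish 0 < start 1
  finish_one_lt : finish 1 < start 2
  finish_two_lt : finish 2 < start 0 + 1
  /-- The strand of the standard picture to which a strand corresponds. -/
  model : Equiv.Perm (Fin 3)
  image_strand : ∀ i, k.path '' Icc (start i) (finish i) =
    C ∩ chart.toHomeo ⁻¹' standardStrand ε (model i)
  notMem_exterior : ∀ i, ∀ t ∈ Ioo (finish i) (![start 1, start 2, start 0 + 1] i), k.path t ∉ C
  /-- The height of a strand: `0` for bottom, `1` for middle, `2` for top. -/
  height : Equiv.Perm (Fin 3)
  over_iff_height : ∀ i j, i ≠ j → ∀ s ∈ Icc (start i) (finish i), ∀ t ∈ Icc (start j) (finish j),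
    k.path s = k.path t → (k.IsOver s ↔ height j < height i)

namespace ThreeStrands

variable {k : KnotDiagram} {C : Set Plane} {ε : ℝ}

/-- The `i`-th strand inside `C`, as a set of parameters. -/
def inside (T : ThreeStrands k C ε) (i : Fin 3) : Set ℝ := Icc (T.start i) (T.finish i)

/-- The parameter where the `i`-th exterior strand ends. This strand starts at `T.finish i` and
connects the strands `i` and `i + 1` inside `C`. -/
def nextStart (T : ThreeStrands k C ε) : Fin 3 → ℝ := ![T.start 1, T.start 2, T.start 0 + 1]

/-- The cyclic order of the strands orients the vanishing triangle: its `i`-th edge leads from the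
crossing with the strand `i - 1` to the crossing with the strand `i + 1`. This says that this
orientation of the `i`-th edge is the one that it has as a part of the knot diagram. -/
def EdgeCoincides (T : ThreeStrands k C ε) (i : Fin 3) : Prop :=
  ∃ s ∈ T.inside i, ∃ t ∈ T.inside i, s < t ∧
    k.path s ∈ k.path '' T.inside (i - 1) ∧ k.path t ∈ k.path '' T.inside (i + 1)

open Classical in
/-- Arnold's sign `q = (-1) ^ n` of the vanishing triangle, where `n` is the number of edges on
which the two orientations coincide. -/
def q (T : ThreeStrands k C ε) : ℤ := (-1) ^ (Finset.univ.filter T.EdgeCoincides).card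

end ThreeStrands

/-- An `Ω₃`-move from `k` to `l` with changing disk `C`: the two diagrams agree outside `C`, and
inside `C` the one is replaced by the other as in the standard pictures, by diffeomorphisms to the
disk which agree on the boundary of `C`. Since a diagram determines its parametrization only up to
an orientation-preserving diffeomorphism of the circle, such a diffeomorphism `φ` (lifted to `ℝ`)
is part of the data. -/
structure Omega3Move (k l : KnotDiagram) (C : Set Plane) where
  before : ThreeStrands k C 1
  after : ThreeStrands l C (-1)
  chart_eq : ∀ p ∈ frontier C, before.chart.toHomeo p = after.chart.toHomeo p
  model_eq : after.model = before.model
  height_eq : after.height = before.height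
  φ : ℝ → ℝ
  φ_smooth : ContDiff ℝ ∞ φ
  φ_deriv_pos : ∀ t, 0 < deriv φ t
  φ_add_one : ∀ t, φ (t + 1) = φ t + 1
  φ_start : ∀ i, φ (before.start i) = after.start i
  φ_finish : ∀ i, φ (before.finish i) = after.finish i
  path_exterior : ∀ i, ∀ t ∈ Icc (before.finish i) (before.nextStart i), l.path (φ t) = k.path t
  over_exterior : ∀ i, ∀ t ∈ Icc (before.finish i) (before.nextStart i),
    (l.IsOver (φ t) ↔ k.IsOver t)

/-- The move is in positive direction (in the sense of Arnold). -/
def Omega3Move.IsPositive {k l : KnotDiagram} {C : Set Plane} (m : Omega3Move k l C) : Prop :=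
  m.before.q = -1 ∧ m.after.q = 1

/-! ### The local link -/

/-- The names of two of the exterior strands. -/
inductive ExteriorStrand
  | a
  | b

namespace ThreeStrands

variable {k : KnotDiagram} {C : Set Plane} {ε : ℝ}

/-- The number of an exterior strand: `a` connects the top and the middle strand inside `C`,
and `b` connects the middle and the bottom strand. -/
def IsNumberOf (T : ThreeStrands k C ε) : ExteriorStrand → Fin 3 → Prop
  | .a, i => ({T.height i, T.height (i + 1)} : Set (Fin 3)) = {2, 1}
  | .b, i => ({T.height i, T.height (i + 1)} : Set (Fin 3)) = {1, 0}

/-- The affine parametrization of the `i`-th exterior strand by `[0, 1/2]`. -/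
def exteriorParam (T : ThreeStrands k C ε) (i : Fin 3) (u : ℝ) : ℝ :=
  AffineMap.lineMap (T.finish i) (T.nextStart i) (2 * u)

/-- `L` is a two-component link diagram that is obtained as follows. Erase the part of `k` inside
`C` and the exterior strand other than `a` and `b`. Connect the ends of `a` by a strand inside `C`,
and the ends of `b` as well, in such a way that the strand that closes `b` does not pass over the
strand that closes `a`. The first half of each component is the exterior strand, the second half is
the strand inside `C`. -/
structure IsLocalLink (T : ThreeStrands k C ε) (L : LinkDiagram ExteriorStrand) : Prop where
  exterior : ∀ c i, T.IsNumberOf c i → ∀ u ∈ Icc (0 : ℝ) (1 / 2),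
    L.curve c u = k.path (T.exteriorParam i u)
  over_exterior : ∀ c i, T.IsNumberOf c i → ∀ u ∈ Icc (0 : ℝ) (1 / 2),
    (∃ p, L.Crosses (pt c u) p) → (pt c u ∈ L.overpass ↔ k.IsOver (T.exteriorParam i u))
  closing : ∀ c, ∀ u ∈ Ioo (1 / 2 : ℝ) 1, L.curve c u ∈ interior C
  closing_not_over : ∀ u ∈ Ioo (1 / 2 : ℝ) 1, ∀ v ∈ Ioo (1 / 2 : ℝ) 1,
    L.curve .b u = L.curve .a v → pt ExteriorStrand.b u ∉ L.overpass

end ThreeStrands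

end

/-!
Three arrows form `w₃` if and only if each of them intersects the next one in a fixed sense
(`Follows`), in a cyclic way. Up to a reparametrization of the circle, the move only interchanges
the adjacent ends of the arrows of the triangle on each of its three strands. Suppose that an
interchange changes the type of a triple. Then two of its arrows belong to the triangle, and the
third one separates their tails, and their heads as well. Two arrows of the triangle that both start
on the top strand, or both end on the bottom strand, cannot be separated in this way, so the triple
contains the arrow from the top to the middle and the arrow from the middle to the bottom strand.
The third arrow then leads from `b` to `a`, and the triple is of type `w₃` on exactly one side of
the move, which depends on the order in which the middle strand passes its two crossings. Hence
`W₃` changes by the sum of the signs of the arrows from `b` to `a`, times a sign that is the product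
of the orientations of the edges of the triangle, which is the value of `q` after the move.

In a local link the strands inside the disk meet the exterior strands only at their ends, and the
strand that closes `b` never passes over the one that closes `a`, so that the sum is the linking
number. To construct a local link, close `a` and `b` by chords of the disk, which meet at most once,
and transversally.
-/

noncomputable section

open ClosedCurves

/-! ### Cyclic orders and the arrow diagram `w₃` -/

/-- The elements `a, b, c, d` of a line that is closed up to a circle are met in this cyclic
order. -/
def CyclicLt {α : Type*} [LT α] (a b c d : α) : Prop :=
  (a < b ∧ b < c ∧ c < d) ∨ (b < c ∧ c < d ∧ d < a) ∨ (c < d ∧ d < a ∧ a < b) ∨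
    (d < a ∧ a < b ∧ b < c)

/-- The weak version of `CyclicLt`. -/
def CyclicLe {α : Type*} [LE α] (a b c d : α) : Prop :=
  (a ≤ b ∧ b ≤ c ∧ c ≤ d) ∨ (b ≤ c ∧ c ≤ d ∧ d ≤ a) ∨ (c ≤ d ∧ d ≤ a ∧ a ≤ b) ∨
    (d ≤ a ∧ a ≤ b ∧ b ≤ c)

instance (a b c d : Fin 6) : Decidable (CyclicLt a b c d) := by
  unfold CyclicLt; infer_instance

instance (a b c d : Fin 6) : Decidable (CyclicLe a b c d) := by
  unfold CyclicLe; infer_instance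

/-- The set `S` consists of three elements that are cyclically related by `R`. -/
def IsCyclicTriple {α : Type*} (R : α → α → Prop) (S : Set α) : Prop :=
  ∃ x y z, S = {x, y, z} ∧ R x y ∧ R y z ∧ R z x

section CyclicTriple

variable {α β : Type*} {R R' : α → α → Prop}

theorem IsCyclicTriple.mono {S : Set α} (h : IsCyclicTriple R S)
    (hRR' : ∀ x ∈ S, ∀ y ∈ S, R x y → R' x y) : IsCyclicTriple R' S := by
  obtain ⟨x, y, z, rfl, hxy, hyz, hzx⟩ := h
  exact ⟨x, y, z, rfl, hRR' _ (by simp) _ (by simp) hxy, hRR' _ (by simp) _ (by simp) hyz,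
    hRR' _ (by simp) _ (by simp) hzx⟩

theorem isCyclicTriple_image {f : α → β} {Q : β → β → Prop} {S : Set α} (hf : InjOn f S) :
    IsCyclicTriple Q (f '' S) ↔ IsCyclicTriple (fun x y => Q (f x) (f y)) S := by
  constructor
  · rintro ⟨x, y, z, hS, hxy, hyz, hzx⟩
    obtain ⟨x, hx, rfl⟩ : x ∈ f '' S := by simp [hS]
    obtain ⟨y, hy, rfl⟩ : y ∈ f '' S := by simp [hS]
    obtain ⟨z, hz, rfl⟩ : z ∈ f '' S := by simp [hS]
    refine ⟨x, y, z, ?_, hxy, hyz, hzx⟩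
    have hxyz : {x, y, z} ⊆ S := by simp [insert_subset_iff, hx, hy, hz]
    exact (hf.image_eq_image_iff Subset.rfl hxyz).1 (by simpa only [image_insert_eq,
      image_singleton] using hS)
  · rintro ⟨x, y, z, rfl, hxy, hyz, hzx⟩
    exact ⟨f x, f y, f z, by simp only [image_insert_eq, image_singleton], hxy, hyz, hzx⟩

theorem IsCyclicTriple.card_eq_three {S : Finset α} (hR : ∀ x, ¬ R x x)
    (h : IsCyclicTriple R (S : Set α)) : S.card = 3 := by
  classical
  obtain ⟨x, y, z, hS, hxy, hyz, hzx⟩ := h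
  have hS' : S = {x, y, z} := Finset.coe_injective (by simpa using hS)
  rw [hS', Finset.card_eq_three]
  refine ⟨x, y, z, ?_, ?_, ?_, rfl⟩ <;> rintro rfl
  exacts [hR _ hxy, hR _ hzx, hR _ hyz]

theorem isCyclicTriple_triple_iff {x y z : α} (hR : ∀ x, ¬ R x x) :
    IsCyclicTriple R {x, y, z} ↔ R x y ∧ R y z ∧ R z x ∨ R y x ∧ R x z ∧ R z y := by
  constructor
  · rintro ⟨u, v, w, hS, huv, hvw, hwu⟩
    have hu : u ∈ ({x, y, z} : Set α) := by simp [hS]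
    have hv : v ∈ ({x, y, z} : Set α) := by simp [hS]
    have hw : w ∈ ({x, y, z} : Set α) := by simp [hS]
    have huv' : u ≠ v := fun h => hR _ (h ▸ huv)
    have hvw' : v ≠ w := fun h => hR _ (h ▸ hvw)
    have hwu' : w ≠ u := fun h => hR _ (h ▸ hwu)
    grind
  · rintro (⟨h₁, h₂, h₃⟩ | ⟨h₁, h₂, h₃⟩)
    exacts [⟨x, y, z, rfl, h₁, h₂, h₃⟩, ⟨y, x, z, insert_comm _ _ _, h₁, h₂, h₃⟩]

open Classical in
/-- The sum, over all sets of three elements of `A` that are cyclically related by `R`, of the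
product of the three signs. The number `w₃` is of this form; see `GaussDiagram.w3_eq`. -/
def cyclicTripleSum (A : Finset α) (R : α → α → Prop) (s : α → ℤ) : ℤ :=
  ∑ S ∈ A.powerset with IsCyclicTriple R ((S : Finset α) : Set α), ∏ x ∈ S, s x

theorem cyclicTripleSum_congr {A : Finset α} {s s' : α → ℤ} (h : ∀ x ∈ A, s x = s' x) :
    cyclicTripleSum A R s = cyclicTripleSum A R s' := by
  classical
  exact Finset.sum_congr rfl fun S hS => Finset.prod_congr rfl fun x hx =>
    h x (Finset.mem_powerset.1 (Finset.mem_filter.1 hS).1 hx)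

theorem cyclicTripleSum_image [DecidableEq β] {A : Finset α} {f : α → β} (hf : InjOn f A)
    (Q : β → β → Prop) (s : β → ℤ) :
    cyclicTripleSum (A.image f) Q s =
      cyclicTripleSum A (fun x y => Q (f x) (f y)) (fun x => s (f x)) := by
  classical
  have hinj : InjOn (Finset.image f) A.powerset := by
    intro S hS T hT h
    have h' : f '' S = f '' T := by
      simpa only [Finset.coe_image] using congrArg (fun U : Finset β => (U : Set β)) h
    have hS' : (S : Set α) ⊆ A := by exact_mod_cast Finset.mem_powerset.1 hS
    have hT' : (T : Set α) ⊆ A := by exact_mod_cast Finset.mem_powerset.1 hT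
    exact_mod_cast (hf.image_eq_image_iff hS' hT').1 h'
  unfold cyclicTripleSum
  simp only [Finset.sum_filter]
  rw [Finset.powerset_image, Finset.sum_image hinj]
  refine Finset.sum_congr rfl fun S hS => ?_
  have hfS : InjOn f S := hf.mono (by exact_mod_cast Finset.mem_powerset.1 hS)
  simp only [Finset.prod_image hfS, Finset.coe_image, isCyclicTriple_image hfS]

open Classical in
theorem filter_isCyclicTriple_eq_image {A : Finset α} {e₁ e₂ : α} (h₁ : e₁ ∈ A) (h₂ : e₂ ∈ A)
    (hne : e₁ ≠ e₂) (hR : ∀ x, ¬ R x x) :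
    (A.powerset.filter fun S : Finset α => IsCyclicTriple R (S : Set α) ∧ e₁ ∈ S ∧ e₂ ∈ S) =
      (A.filter fun x => IsCyclicTriple R {e₁, e₂, x}).image fun x => {e₁, e₂, x} := by
  ext S
  simp only [Finset.mem_filter, Finset.mem_powerset, Finset.mem_image]
  constructor
  · rintro ⟨hSA, hS, he₁, he₂⟩
    have hcard : ((S.erase e₁).erase e₂).card = 1 := by
      rw [Finset.card_erase_of_mem (Finset.mem_erase.2 ⟨hne.symm, he₂⟩),
        Finset.card_erase_of_mem he₁, hS.card_eq_three hR]
    obtain ⟨x, hx⟩ := Finset.card_eq_one.1 hcard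
    have hSx : {e₁, e₂, x} = S := by
      rw [← hx, Finset.insert_erase (Finset.mem_erase.2 ⟨hne.symm, he₂⟩),
        Finset.insert_erase he₁]
    refine ⟨x, ⟨hSA (by simp [← hSx]), ?_⟩, hSx⟩
    simpa only [← hSx, Finset.coe_insert, Finset.coe_singleton] using hS
  · rintro ⟨x, ⟨hx, hx'⟩, rfl⟩
    simp [Finset.insert_subset_iff, h₁, h₂, hx, hx']

open Classical in
theorem cyclicTripleSum_eq_add {A : Finset α} (s : α → ℤ) {e₁ e₂ : α} (h₁ : e₁ ∈ A)
    (h₂ : e₂ ∈ A) (hne : e₁ ≠ e₂) (hR : ∀ x, ¬ R x x) :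
    cyclicTripleSum A R s = s e₁ * s e₂ * ∑ x ∈ A with IsCyclicTriple R {e₁, e₂, x}, s x +
      ∑ S ∈ A.powerset with IsCyclicTriple R ((S : Finset α) : Set α) ∧ ¬ (e₁ ∈ S ∧ e₂ ∈ S),
        ∏ x ∈ S, s x := by
  have hne' : ∀ x, IsCyclicTriple R {e₁, e₂, x} → e₁ ≠ x ∧ e₂ ≠ x := by
    intro x hx
    have hcard : ({e₁, e₂, x} : Finset α).card = 3 := IsCyclicTriple.card_eq_three hR (by simpa)
    constructor <;> rintro rfl
    · simp [Finset.pair_comm e₂, Finset.card_pair hne] at hcard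
    · simp [Finset.card_pair hne] at hcard
  have hinj : InjOn (fun x => ({e₁, e₂, x} : Finset α))
      (A.filter fun x => IsCyclicTriple R {e₁, e₂, x}) := by
    intro x hx y _ hxy
    obtain ⟨hx₁, hx₂⟩ := hne' x (Finset.mem_filter.1 hx).2
    have hmem : x ∈ ({e₁, e₂, y} : Finset α) := by
      rw [← show ({e₁, e₂, x} : Finset α) = {e₁, e₂, y} from hxy]
      simp
    simpa [hx₁.symm, hx₂.symm] using hmem
  rw [cyclicTripleSum, ← Finset.sum_filter_add_sum_filter_not _ fun S => e₁ ∈ S ∧ e₂ ∈ S,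
    Finset.filter_filter, Finset.filter_filter, filter_isCyclicTriple_eq_image h₁ h₂ hne hR,
    Finset.sum_image hinj, Finset.mul_sum]
  congr 1
  refine Finset.sum_congr rfl fun x hx => ?_
  obtain ⟨hx₁, hx₂⟩ := hne' x (Finset.mem_filter.1 hx).2
  rw [Finset.prod_insert (by simp [hne, hx₁]), Finset.prod_pair hx₂, mul_assoc]

open Classical in
theorem cyclicTripleSum_sub {A : Finset α} (s : α → ℤ) {e₁ e₂ : α} (h₁ : e₁ ∈ A) (h₂ : e₂ ∈ A)
    (hne : e₁ ≠ e₂) (hR : ∀ x, ¬ R x x) (hR' : ∀ x, ¬ R' x x)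
    (hRR' : ∀ S ⊆ A, ¬ (e₁ ∈ S ∧ e₂ ∈ S) →
      (IsCyclicTriple R' (S : Set α) ↔ IsCyclicTriple R (S : Set α))) :
    cyclicTripleSum A R' s - cyclicTripleSum A R s = s e₁ * s e₂ *
      ((∑ x ∈ A with IsCyclicTriple R' {e₁, e₂, x}, s x) -
        ∑ x ∈ A with IsCyclicTriple R {e₁, e₂, x}, s x) := by
  have hrest :
      (A.powerset.filter fun S : Finset α =>
        IsCyclicTriple R' (S : Set α) ∧ ¬ (e₁ ∈ S ∧ e₂ ∈ S)) =
      A.powerset.filter fun S : Finset α =>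
        IsCyclicTriple R (S : Set α) ∧ ¬ (e₁ ∈ S ∧ e₂ ∈ S) :=
    Finset.filter_congr fun S hS =>
      and_congr_left fun h => hRR' S (Finset.mem_powerset.1 hS) h
  rw [cyclicTripleSum_eq_add s h₁ h₂ hne hR, cyclicTripleSum_eq_add s h₁ h₂ hne hR', hrest]
  ring

end CyclicTriple

namespace ClosedCurves

/-- The arrows on the circles indexed by `ι`, given by their tails and heads. -/
abbrev Arrow (ι : Type) : Type := Pt ι × Pt ι

variable {ι : Type}

/-- The parameter in `[a, a + 1)` of a point of the parametrizing circles. -/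
def rep (a : ℝ) (p : Pt ι) : ℝ := AddCircle.equivIco 1 a p.2

theorem rep_mem (a : ℝ) (p : Pt ι) : rep a p ∈ Ico a (a + 1) := (AddCircle.equivIco 1 a p.2).2

theorem pt_rep (a : ℝ) (p : Pt ι) : pt p.1 (rep a p) = p :=
  Prod.ext rfl (AddCircle.coe_equivIco (p := (1 : ℝ)) (a := a) (y := p.2))

theorem pt_rep_unit (a : ℝ) (p : Pt Unit) : pt () (rep a p) = p := pt_rep a p

theorem rep_pt {a t : ℝ} (i : ι) (ht : t ∈ Ico a (a + 1)) : rep a (pt i t) = t :=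
  AddCircle.equivIco_coe_of_mem (p := (1 : ℝ)) (a := a) ht

theorem pt_add_one (i : ι) (t : ℝ) : pt i (t + 1) = pt i t :=
  Prod.ext rfl (AddCircle.coe_add_period (1 : ℝ) t)

theorem pt_eq_iff {i j : ι} {s t : ℝ} : pt i s = pt j t ↔ i = j ∧ ∃ n : ℤ, s = t + n := by
  rw [pt, pt, Prod.mk.injEq]
  refine and_congr_right fun _ => ?_
  rw [← sub_eq_zero, ← AddCircle.coe_sub, AddCircle.coe_eq_zero_iff]
  simp only [zsmul_one, eq_comm (b := s - t), sub_eq_iff_eq_add']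

theorem pt_eq_iff_of_mem {i j : ι} {a s t : ℝ} (hs : s ∈ Ico a (a + 1)) (ht : t ∈ Ico a (a + 1)) :
    pt i s = pt j t ↔ i = j ∧ s = t := by
  rw [pt, pt, Prod.mk.injEq, AddCircle.coe_eq_coe_iff_of_mem_Ico (p := (1 : ℝ)) hs ht]

theorem pt_add_intCast (i : ι) (t : ℝ) (n : ℤ) : pt i (t + n) = pt i t :=
  pt_eq_iff.2 ⟨rfl, n, rfl⟩

theorem exists_rep_pt_eq_add (a : ℝ) (i : ι) (t : ℝ) : ∃ n : ℤ, rep a (pt i t) = t + n :=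
  (pt_eq_iff.1 (pt_rep a (pt i t))).2

theorem rep_injective (a : ℝ) : Function.Injective (rep a : Pt Unit → ℝ) :=
  Function.LeftInverse.injective (pt_rep_unit a)

theorem exists_rep_pt_eq_ite (s : ℝ) (i : ι) (a : ℝ) : ∃ n : ℤ, a + n ∈ Ico s (s + 1) ∧
    ∀ t ∈ Ico a (a + 1),
      rep s (pt i t) = if t + n < s + 1 then t + (n : ℝ) else t + (n : ℝ) - 1 := by
  obtain ⟨n, hn⟩ := exists_rep_pt_eq_add s i a
  have hmem : a + n ∈ Ico s (s + 1) := hn ▸ rep_mem s (pt i a)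
  refine ⟨n, hmem, fun t ht => ?_⟩
  split_ifs with h
  · rw [← pt_add_intCast i t n, rep_pt i ⟨by linarith [hmem.1, ht.1], h⟩]
  · rw [← pt_add_intCast i t n, ← sub_add_cancel (t + (n : ℝ)) 1, pt_add_one,
      rep_pt i ⟨by linarith, by linarith [hmem.2, ht.2]⟩]
    ring

theorem cyclicLt_rep (s : ℝ) (i : ι) {a b c d : ℝ} (hab : a < b) (hbc : b < c) (hcd : c < d)
    (hda : d < a + 1) :
    CyclicLt (rep s (pt i a)) (rep s (pt i b)) (rep s (pt i c)) (rep s (pt i d)) := by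
  obtain ⟨n, hn, hrep⟩ := exists_rep_pt_eq_ite s i a
  rw [hrep a ⟨le_rfl, by linarith⟩, hrep b ⟨hab.le, by linarith⟩,
    hrep c ⟨by linarith, by linarith⟩, hrep d ⟨by linarith, hda⟩]
  have := hn.1
  have := hn.2
  unfold CyclicLt
  grind

/-- The arrows `x` and `y` intersect, and the ends are met in the cyclic order tail of `x`, tail of
`y`, head of `x`, head of `y`. The relation does not depend on the point `a` at which the circle is
cut. -/
def Follows (a : ℝ) (x y : Arrow Unit) : Prop :=
  CyclicLt (rep a x.1) (rep a y.1) (rep a x.2) (rep a y.2)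

theorem not_follows_self (a : ℝ) (x : Arrow Unit) : ¬ Follows a x x := by
  unfold Follows CyclicLt
  grind

theorem _root_.IsW3.isCyclicTriple {S : Finset (Arrow Unit)} (hS : IsW3 S) (a : ℝ) :
    IsCyclicTriple (Follows a) (S : Set (Arrow Unit)) := by
  obtain ⟨r, hr, hr₅, hS⟩ := hS
  have h01 : r 0 < r 1 := hr (by decide)
  have h12 : r 1 < r 2 := hr (by decide)
  have h23 : r 2 < r 3 := hr (by decide)
  have h34 : r 3 < r 4 := hr (by decide)
  have h45 : r 4 < r 5 := hr (by decide)
  refine ⟨_, _, _, hS, ?_, ?_, ?_⟩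
  · exact cyclicLt_rep a () (h01.trans h12) h23 (h34.trans h45) hr₅
  · rw [← pt_add_one () (r 1)]
    exact cyclicLt_rep a () (h23.trans h34) h45 (by linarith) (by linarith)
  · rw [← pt_add_one () (r 0), ← pt_add_one () (r 1), ← pt_add_one () (r 3)]
    exact cyclicLt_rep a () (by linarith) (by linarith) (by linarith) (by linarith)

theorem cyclic_order_of_cyclicLt {s a₁ a₂ b₁ b₂ c₁ c₂ : ℝ} (ha₁ : a₁ ∈ Ico s (s + 1))
    (ha₂ : a₂ ∈ Ico s (s + 1)) (hb₁ : b₁ ∈ Ico s (s + 1)) (hb₂ : b₂ ∈ Ico s (s + 1))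
    (hc₁ : c₁ ∈ Ico s (s + 1)) (hc₂ : c₂ ∈ Ico s (s + 1)) (hab : CyclicLt a₁ b₁ a₂ b₂)
    (hbc : CyclicLt b₁ c₁ b₂ c₂) (hca : CyclicLt c₁ a₁ c₂ a₂) {f : ℝ → ℝ}
    (hf : ∀ x, f x = if x < a₁ then x + 1 else x) :
    a₁ < f c₂ ∧ f c₂ < f b₁ ∧ f b₁ < f a₂ ∧ f a₂ < f c₁ ∧ f c₁ < f b₂ ∧ f b₂ < a₁ + 1 := by
  simp only [hf]
  obtain ⟨⟨_, _⟩, ⟨_, _⟩, ⟨_, _⟩, ⟨_, _⟩, ⟨_, _⟩, ⟨_, _⟩⟩ := ha₁, ha₂, hb₁, hb₂, hc₁, hc₂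
  unfold CyclicLt at *
  grind

theorem isW3_of_isCyclicTriple {a : ℝ} {S : Finset (Arrow Unit)}
    (hS : IsCyclicTriple (Follows a) (S : Set (Arrow Unit))) : IsW3 S := by
  obtain ⟨x, y, z, hS, hxy, hyz, hzx⟩ := hS
  obtain ⟨f, hf⟩ : ∃ f : ℝ → ℝ, ∀ t, f t = if t < rep a x.1 then t + 1 else t :=
    ⟨_, fun _ => rfl⟩
  obtain ⟨h₁, h₂, h₃, h₄, h₅, h₆⟩ := cyclic_order_of_cyclicLt (rep_mem a x.1) (rep_mem a x.2)
    (rep_mem a y.1) (rep_mem a y.2) (rep_mem a z.1) (rep_mem a z.2) hxy hyz hzx hf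
  have hpt : ∀ p : Pt Unit, pt () (f (rep a p)) = p := by
    intro p
    rw [hf]
    split_ifs
    · rw [pt_add_one, pt_rep_unit]
    · rw [pt_rep_unit]
  refine ⟨![rep a x.1, f (rep a z.2), f (rep a y.1), f (rep a x.2), f (rep a z.1),
    f (rep a y.2)], ?_, h₆, ?_⟩
  · rw [Fin.strictMono_iff_lt_succ]
    intro i
    fin_cases i
    exacts [h₁, h₂, h₃, h₄, h₅]
  · change (S : Set (Arrow Unit)) = {(pt () (rep a x.1), pt () (f (rep a x.2))),
      (pt () (f (rep a y.1)), pt () (f (rep a y.2))),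
      (pt () (f (rep a z.1)), pt () (f (rep a z.2)))}
    simpa only [hpt, pt_rep_unit] using hS

end ClosedCurves

theorem isW3_iff_isCyclicTriple (a : ℝ) (S : Finset (Arrow Unit)) :
    IsW3 S ↔ IsCyclicTriple (Follows a) (S : Set (Arrow Unit)) :=
  ⟨fun h => h.isCyclicTriple a, isW3_of_isCyclicTriple⟩

theorem GaussDiagram.w3_eq (G : GaussDiagram Unit) (a : ℝ) :
    G.w3 = cyclicTripleSum G.arrows (Follows a) G.sign := by
  classical
  unfold GaussDiagram.w3 cyclicTripleSum
  simp only [Finset.sum_filter, isW3_iff_isCyclicTriple a]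

/-! ### Linear algebra of the plane -/

theorem planeDet_map (D : Plane →L[ℝ] Plane) (v w : Plane) :
    planeDet (D v) (D w) = D.det * planeDet v w := by
  have hdet : D.det = D (EuclideanSpace.single 0 1) 0 * D (EuclideanSpace.single 1 1) 1 -
      D (EuclideanSpace.single 1 1) 0 * D (EuclideanSpace.single 0 1) 1 := by
    rw [ContinuousLinearMap.det,
      ← LinearMap.det_toMatrix (EuclideanSpace.basisFun (Fin 2) ℝ).toBasis, Matrix.det_fin_two]
    simp [LinearMap.toMatrix_apply]
  have hD : ∀ (v : Plane) (i : Fin 2), D v i =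
      v 0 * D (EuclideanSpace.single 0 1) i + v 1 * D (EuclideanSpace.single 1 1) i := by
    intro v i
    have hv : v = v 0 • EuclideanSpace.single (0 : Fin 2) (1 : ℝ) +
        v 1 • EuclideanSpace.single (1 : Fin 2) (1 : ℝ) := by
      ext i; fin_cases i <;> simp
    conv_lhs => rw [hv]
    simp
  rw [planeDet, planeDet, hdet, hD v 0, hD v 1, hD w 0, hD w 1]
  ring

theorem planeDet_smul_smul (a b : ℝ) (v w : Plane) :
    planeDet (a • v) (b • w) = a * b * planeDet v w := by
  simp only [planeDet, PiLp.smul_apply, smul_eq_mul]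
  ring

theorem plane_ext {p q : Plane} (h0 : p 0 = q 0) (h1 : p 1 = q 1) : p = q := by
  ext i; fin_cases i <;> assumption

theorem plane_norm_sq (p : Plane) : ‖p‖ ^ 2 = p 0 ^ 2 + p 1 ^ 2 := by
  rw [EuclideanSpace.norm_sq_eq, Fin.sum_univ_two]; simp

theorem plane_mem_closedBall {p : Plane} :
    p ∈ Metric.closedBall (0 : Plane) 1 ↔ p 0 ^ 2 + p 1 ^ 2 ≤ 1 := by
  rw [mem_closedBall_zero_iff, ← plane_norm_sq, sq_le_one_iff₀ (norm_nonneg p)]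

theorem plane_mem_ball {p : Plane} : p ∈ Metric.ball (0 : Plane) 1 ↔ p 0 ^ 2 + p 1 ^ 2 < 1 := by
  rw [mem_ball_zero_iff, ← plane_norm_sq, sq_lt_one_iff₀ (norm_nonneg p)]

/-! ### Knot diagrams -/
namespace KnotDiagram

variable (k : KnotDiagram)

theorem path_add_one (t : ℝ) : k.path (t + 1) = k.path t := k.periodic () t

theorem hasDerivAt_path (t : ℝ) : HasDerivAt k.path (deriv k.path t) t :=
  ((k.regular t).1.differentiableAt (by simp)).hasDerivAt

theorem deriv_path_ne_zero (t : ℝ) : deriv k.path t ≠ 0 := (k.regular t).2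

theorem velocity_eq_deriv (t : ℝ) : k.velocity (pt () t) = deriv k.path t := velocity_pt _ _ _

theorem eval_eq_path (t : ℝ) : k.eval (pt () t) = k.path t := eval_pt _ _ _

theorem crosses_iff {s t : ℝ} :
    k.Crosses (pt () s) (pt () t) ↔ pt () s ≠ pt () t ∧ k.path s = k.path t := by
  rw [Crosses, eval_eq_path, eval_eq_path]

end KnotDiagram

theorem ClosedCurves.Crosses.symm {ι : Type} {L : ClosedCurves ι} {p q : Pt ι}
    (h : L.Crosses p q) : L.Crosses q p := ⟨h.1.symm, h.2.symm⟩

theorem LinkDiagram.mem_arrows {ι : Type} (L : LinkDiagram ι) (x : Arrow ι) :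
    x ∈ L.gaussDiagram.arrows ↔ L.Crosses x.1 x.2 ∧ x.1 ∈ L.overpass := by
  simp [LinkDiagram.gaussDiagram]

/-! ### Disk charts -/

namespace DiskChart

variable {C : Set Plane} (χ : DiskChart C)

theorem mem_closedBall {p : Plane} (hp : p ∈ C) : χ.toHomeo p ∈ Metric.closedBall (0 : Plane) 1 :=
  χ.image_eq ▸ mem_image_of_mem _ hp

theorem mem_iff {p : Plane} (hp : p ∈ χ.toHomeo.source) :
    p ∈ C ↔ χ.toHomeo p ∈ Metric.closedBall (0 : Plane) 1 := by
  refine ⟨χ.mem_closedBall, fun h => ?_⟩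
  rw [← χ.image_eq] at h
  obtain ⟨c, hc, e⟩ := h
  rwa [← χ.toHomeo.injOn (χ.subset_source hc) hp e]

theorem closedBall_subset_target : Metric.closedBall (0 : Plane) 1 ⊆ χ.toHomeo.target := by
  rw [← χ.image_eq]
  rintro _ ⟨c, hc, rfl⟩
  exact χ.toHomeo.map_source (χ.subset_source hc)

theorem symm_mem {p : Plane} (hp : p ∈ Metric.closedBall (0 : Plane) 1) :
    χ.toHomeo.symm p ∈ C := by
  rw [χ.mem_iff (χ.toHomeo.map_target (χ.closedBall_subset_target hp)),
    χ.toHomeo.right_inv (χ.closedBall_subset_target hp)]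
  exact hp

theorem mem_interior_iff {p : Plane} (hp : p ∈ C) :
    p ∈ interior C ↔ χ.toHomeo p ∈ Metric.ball (0 : Plane) 1 := by
  constructor
  · intro h
    have hsub : χ.toHomeo '' interior C ⊆ interior (Metric.closedBall (0 : Plane) 1) := by
      apply interior_maximal
      · rw [← χ.image_eq]; exact image_mono interior_subset
      · exact χ.toHomeo.isOpen_image_of_subset_source isOpen_interior
          (interior_subset.trans χ.subset_source)
    rw [interior_closedBall _ one_ne_zero] at hsub
    exact hsub (mem_image_of_mem _ h)
  · intro h
    refine mem_interior.2 ⟨χ.toHomeo.source ∩ χ.toHomeo ⁻¹' Metric.ball 0 1, ?_,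
      χ.toHomeo.isOpen_inter_preimage Metric.isOpen_ball, χ.subset_source hp, h⟩
    intro q hq
    exact (χ.mem_iff hq.1).2 (Metric.ball_subset_closedBall hq.2)

theorem mem_frontier {p : Plane} (hp : p ∈ C) (h : χ.toHomeo p ∉ Metric.ball (0 : Plane) 1) :
    p ∈ frontier C :=
  ⟨subset_closure hp, fun hi => h ((χ.mem_interior_iff hp).1 hi)⟩

theorem injOn : Set.InjOn χ.toHomeo C := χ.toHomeo.injOn.mono χ.subset_source

theorem contDiffAt {p : Plane} (hp : p ∈ χ.toHomeo.source) : ContDiffAt ℝ ∞ χ.toHomeo p :=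
  χ.smooth.contDiffAt (χ.toHomeo.open_source.mem_nhds hp)

theorem hasFDerivAt {p : Plane} (hp : p ∈ χ.toHomeo.source) :
    HasFDerivAt χ.toHomeo (fderiv ℝ χ.toHomeo p) p :=
  ((χ.contDiffAt hp).differentiableAt (by simp)).hasFDerivAt

theorem contDiffAt_symm {p : Plane} (hp : p ∈ χ.toHomeo.target) :
    ContDiffAt ℝ ∞ χ.toHomeo.symm p :=
  χ.smooth_symm.contDiffAt (χ.toHomeo.open_target.mem_nhds hp)

theorem hasFDerivAt_symm {p : Plane} (hp : p ∈ χ.toHomeo.target) :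
    HasFDerivAt χ.toHomeo.symm (fderiv ℝ χ.toHomeo.symm p) p :=
  ((χ.contDiffAt_symm hp).differentiableAt (by simp)).hasFDerivAt

theorem fderiv_fderiv_symm {p : Plane} (hp : p ∈ χ.toHomeo.target) (v : Plane) :
    fderiv ℝ χ.toHomeo (χ.toHomeo.symm p) (fderiv ℝ χ.toHomeo.symm p v) = v := by
  have h := (χ.hasFDerivAt (χ.toHomeo.map_target hp)).comp p (χ.hasFDerivAt_symm hp)
  have h' : HasFDerivAt (χ.toHomeo ∘ χ.toHomeo.symm) (ContinuousLinearMap.id ℝ Plane) p :=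
    (hasFDerivAt_id p).congr_of_eventuallyEq
      (Filter.eventually_of_mem (χ.toHomeo.open_target.mem_nhds hp) fun q hq =>
        χ.toHomeo.right_inv hq)
  exact congrArg (fun D : Plane →L[ℝ] Plane => D v) (h.unique h')

theorem sign_planeDet_fderiv {p : Plane} (hp : p ∈ χ.toHomeo.source) (v w : Plane) :
    SignType.sign (planeDet (fderiv ℝ χ.toHomeo p v) (fderiv ℝ χ.toHomeo p w)) =
      SignType.sign (planeDet v w) := by
  rw [planeDet_map, sign_mul, sign_pos (χ.orientation p hp), one_mul]

theorem fderiv_ne_zero {p : Plane} (hp : p ∈ χ.toHomeo.source) {v : Plane} (hv : v ≠ 0) :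
    fderiv ℝ χ.toHomeo p v ≠ 0 := by
  intro h
  have hdet : ∀ w, planeDet v w = 0 := fun w => by
    have hw := planeDet_map (fderiv ℝ χ.toHomeo p) v w
    rw [h] at hw
    simpa [planeDet, (χ.orientation p hp).ne'] using hw
  exact hv (plane_ext (by simpa [planeDet] using hdet (EuclideanSpace.single 1 1))
    (by simpa [planeDet] using hdet (EuclideanSpace.single 0 1)))

end DiskChart

/-! ### The standard strands -/

/-- The standard strands are the graphs of these functions. -/
def modelFun (ε : ℝ) : Fin 3 → ℝ → ℝ := ![fun x => x, fun x => -x, fun x => ε * (1 - x ^ 2) / 2]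

/-- The slopes of the standard strands. -/
def modelSlope (ε : ℝ) : Fin 3 → ℝ → ℝ := ![fun _ => 1, fun _ => -1, fun x => -ε * x]

/-- The first coordinate of the right end of a standard strand. -/
def modelEnd : Fin 3 → ℝ := ![√2 / 2, √2 / 2, 1]

/-- The first coordinate of the crossing of two standard strands. -/
def modelCross (ε : ℝ) : Fin 3 → Fin 3 → ℝ :=
  ![![0, 0, ε * (√2 - 1)], ![0, 0, -ε * (√2 - 1)], ![ε * (√2 - 1), -ε * (√2 - 1), 0]]

/-- The sign of a crossing of two standard strands directed from left to right. -/
def modelSign : Fin 3 → Fin 3 → ℤ := ![![0, -1, -1], ![1, 0, 1], ![1, -1, 0]]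

/-- The position of the crossings on a standard strand: `modelOrder m = 1` if in the picture with
`ε = 1` the crossing with the strand `m - 1` is to the left of the crossing with `m + 1`. -/
def modelOrder : Fin 3 → ℤ := ![-1, -1, 1]

theorem mem_standardStrand {ε : ℝ} {m : Fin 3} {p : Plane} :
    p ∈ standardStrand ε m ↔ p ∈ Metric.closedBall (0 : Plane) 1 ∧ p 1 = modelFun ε m (p 0) := by
  fin_cases m <;> rfl

theorem hasDerivAt_modelFun (ε : ℝ) (m : Fin 3) (x : ℝ) :
    HasDerivAt (modelFun ε m) (modelSlope ε m x) x := by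
  fin_cases m
  · exact hasDerivAt_id x
  · exact (hasDerivAt_id x).neg
  · refine (((((hasDerivAt_id x).pow 2).const_sub 1).const_mul ε).div_const 2).congr_deriv ?_
    change _ = -ε * x
    norm_num
    ring

theorem sqrt_two_bounds : 1.4 < √2 ∧ √2 < 1.5 ∧ √2 ^ 2 = 2 :=
  ⟨Real.lt_sqrt_of_sq_lt (by norm_num), (Real.sqrt_lt' (by norm_num)).2 (by norm_num),
    Real.sq_sqrt (by norm_num)⟩

theorem modelEnd_pos (m : Fin 3) : 0 < modelEnd m := by
  fin_cases m <;> simp [modelEnd]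

theorem sq_add_modelFun_sq_le_one_iff {ε : ℝ} (hε : ε ^ 2 = 1) (m : Fin 3) (x : ℝ) :
    x ^ 2 + modelFun ε m x ^ 2 ≤ 1 ↔ x ∈ Icc (-modelEnd m) (modelEnd m) := by
  obtain ⟨-, -, hsq⟩ := sqrt_two_bounds
  rw [mem_Icc, ← abs_le, ← sq_le_sq₀ (abs_nonneg x) (modelEnd_pos m).le, sq_abs]
  fin_cases m
  · change x ^ 2 + x ^ 2 ≤ 1 ↔ x ^ 2 ≤ (√2 / 2) ^ 2
    constructor <;> intro h <;> linarith
  · change x ^ 2 + (-x) ^ 2 ≤ 1 ↔ x ^ 2 ≤ (√2 / 2) ^ 2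
    constructor <;> intro h <;> linarith
  · change x ^ 2 + (ε * (1 - x ^ 2) / 2) ^ 2 ≤ 1 ↔ x ^ 2 ≤ 1 ^ 2
    rw [div_pow, mul_pow, hε]
    constructor <;> intro h
    · nlinarith [sq_nonneg (1 - x ^ 2)]
    · nlinarith [sq_nonneg (1 - x ^ 2), sq_nonneg x]

theorem sq_add_modelFun_sq_eq_one {ε : ℝ} (hε : ε ^ 2 = 1) (m : Fin 3) {x : ℝ}
    (hx : x ^ 2 = modelEnd m ^ 2) : x ^ 2 + modelFun ε m x ^ 2 = 1 := by
  obtain ⟨-, -, hsq⟩ := sqrt_two_bounds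
  fin_cases m
  · change x ^ 2 = (√2 / 2) ^ 2 at hx
    change x ^ 2 + x ^ 2 = 1
    linarith
  · change x ^ 2 = (√2 / 2) ^ 2 at hx
    change x ^ 2 + (-x) ^ 2 = 1
    linarith
  · change x ^ 2 = 1 ^ 2 at hx
    change x ^ 2 + (ε * (1 - x ^ 2) / 2) ^ 2 = 1
    rw [div_pow, mul_pow, hε, hx]
    norm_num

theorem modelCross_comm (ε : ℝ) (m n : Fin 3) : modelCross ε m n = modelCross ε n m := by
  fin_cases m <;> fin_cases n <;> rfl

theorem modelCross_mem {ε : ℝ} (hε : ε ^ 2 = 1) (m n : Fin 3) :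
    modelCross ε m n ∈ Ioo (-modelEnd m) (modelEnd m) := by
  obtain ⟨hgt, hlt, -⟩ := sqrt_two_bounds
  rcases sq_eq_one_iff.1 hε with rfl | rfl <;> fin_cases m <;> fin_cases n <;>
    simp only [modelCross, modelEnd, Fin.isValue, Fin.zero_eta, Fin.mk_one, Fin.reduceFinMk,
      Matrix.cons_val, mem_Ioo] <;>
    constructor <;> linarith

theorem eq_half_one_sub_sq_iff {y : ℝ} (hy : -1 ≤ y) : y = (1 - y ^ 2) / 2 ↔ y = √2 - 1 := by
  obtain ⟨hlt, -, hsq⟩ := sqrt_two_bounds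
  constructor
  · intro h
    have hroots : (y - (√2 - 1)) * (y + √2 + 1) = 0 := by linear_combination 2 * h - hsq
    rcases mul_eq_zero.1 hroots with h' | h' <;> linarith
  · rintro rfl
    linear_combination hsq / 2

theorem modelEnd_le_one (m : Fin 3) : modelEnd m ≤ 1 := by
  obtain ⟨-, hlt, -⟩ := sqrt_two_bounds
  fin_cases m
  exacts [show √2 / 2 ≤ 1 by linarith, show √2 / 2 ≤ 1 by linarith, le_rfl]

theorem modelFun_eq_iff {ε : ℝ} (hε : ε ^ 2 = 1) {m n : Fin 3} (hmn : m ≠ n) {x : ℝ}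
    (hx : x ∈ Icc (-modelEnd m) (modelEnd m)) :
    modelFun ε m x = modelFun ε n x ↔ x = modelCross ε m n := by
  have hpos := eq_half_one_sub_sq_iff (y := x) (by linarith [hx.1, modelEnd_le_one m])
  have hneg := eq_half_one_sub_sq_iff (y := -x) (by linarith [hx.2, modelEnd_le_one m])
  rw [neg_sq] at hneg
  rcases sq_eq_one_iff.1 hε with rfl | rfl <;> fin_cases m <;> fin_cases n <;>
    first
    | exact absurd rfl hmn
    | (simp only [modelCross, modelFun, Fin.isValue, Fin.zero_eta, Fin.mk_one, Fin.reduceFinMk,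
        Matrix.cons_val]
       grind)

theorem coe_sign_of_pos {x : ℝ} (hx : 0 < x) : (SignType.sign x : ℤ) = 1 := by
  rw [sign_pos hx]; rfl

theorem coe_sign_of_neg {x : ℝ} (hx : x < 0) : (SignType.sign x : ℤ) = -1 := by
  rw [sign_neg hx]; rfl

theorem sign_modelSlope {ε : ℝ} (hε : ε ^ 2 = 1) {m n : Fin 3} (hmn : m ≠ n) :
    (SignType.sign (modelSlope ε n (modelCross ε m n) - modelSlope ε m (modelCross ε m n)) : ℤ) =
      modelSign m n := by
  obtain ⟨hgt, -, -⟩ := sqrt_two_bounds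
  rcases sq_eq_one_iff.1 hε with rfl | rfl <;> fin_cases m <;> fin_cases n <;>
    first
    | exact absurd rfl hmn
    | (refine coe_sign_of_pos ?_
       simp only [modelSlope, modelCross, Fin.isValue, Fin.zero_eta, Fin.mk_one, Fin.reduceFinMk,
        Matrix.cons_val]
       linarith)
    | (refine coe_sign_of_neg ?_
       simp only [modelSlope, modelCross, Fin.isValue, Fin.zero_eta, Fin.mk_one, Fin.reduceFinMk,
        Matrix.cons_val]
       linarith)

theorem sign_modelCross {ε : ℝ} (hε : ε ^ 2 = 1) (m : Fin 3) :
    (SignType.sign (ε * (modelCross ε m (m + 1) - modelCross ε m (m - 1))) : ℤ) =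
      modelOrder m := by
  obtain ⟨hgt, -, -⟩ := sqrt_two_bounds
  rcases sq_eq_one_iff.1 hε with rfl | rfl <;> fin_cases m
  · exact coe_sign_of_neg (show 1 * (0 - 1 * (√2 - 1)) < 0 by linarith)
  · exact coe_sign_of_neg (show 1 * (-1 * (√2 - 1) - 0) < 0 by linarith)
  · exact coe_sign_of_pos (show 0 < 1 * (1 * (√2 - 1) - -1 * (√2 - 1)) by linarith)
  · exact coe_sign_of_neg (show -1 * (0 - -1 * (√2 - 1)) < 0 by linarith)
  · exact coe_sign_of_neg (show -1 * (- -1 * (√2 - 1) - 0) < 0 by linarith)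
  · exact coe_sign_of_pos (show 0 < -1 * (-1 * (√2 - 1) - - -1 * (√2 - 1)) by linarith)

/-! ### The strands inside the changing disk -/

namespace ThreeStrands

variable {k : KnotDiagram} {C : Set Plane} {ε : ℝ} (T : ThreeStrands k C ε)

/-- The knot diagram in the coordinates given by the chart. -/
def chartPath (t : ℝ) : Plane := T.chart.toHomeo (k.path t)

/-- The velocity of the knot diagram in the coordinates given by the chart. -/
def chartVelocity (t : ℝ) : Plane := fderiv ℝ T.chart.toHomeo (k.path t) (deriv k.path t)

/-- The direction of a strand: `1` if it runs from left to right and `-1` otherwise. -/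
def direction (i : Fin 3) : ℤ := if 0 < T.chartVelocity (T.start i) 0 then 1 else -1

/-- The parameter on the strand `i` of the crossing with the strand `j`. -/
def crossParam (i j : Fin 3) : ℝ :=
  Function.invFunOn (fun t => T.chartPath t 0) (T.inside i) (modelCross ε (T.model i) (T.model j))

/-- This is `1` if the strands are passed in the cyclic order of the standard strands, and `-1`
otherwise. -/
def cyclicParity : ℤ := if T.model 1 = T.model 0 + 1 then 1 else -1

theorem start_mem (i : Fin 3) : T.start i ∈ T.inside i := left_mem_Icc.2 (T.start_lt_finish i).le

theorem finish_mem (i : Fin 3) : T.finish i ∈ T.inside i :=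
  right_mem_Icc.2 (T.start_lt_finish i).le

theorem direction_eq (i : Fin 3) : T.direction i = 1 ∨ T.direction i = -1 :=
  ite_eq_or_eq _ _ _

theorem direction_mul_self (i : Fin 3) : (T.direction i : ℝ) * T.direction i = 1 := by
  rcases T.direction_eq i with h | h <;> rw [h] <;> norm_num

theorem cyclicParity_eq : T.cyclicParity = 1 ∨ T.cyclicParity = -1 := ite_eq_or_eq _ _ _

variable {i j : Fin 3} {s t : ℝ}

theorem path_mem (ht : t ∈ T.inside i) : k.path t ∈ C :=
  ((T.image_strand i).subset (mem_image_of_mem _ ht)).1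

theorem chartPath_mem (ht : t ∈ T.inside i) : T.chartPath t ∈ standardStrand ε (T.model i) :=
  ((T.image_strand i).subset (mem_image_of_mem _ ht)).2

theorem chartPath_one (ht : t ∈ T.inside i) :
    T.chartPath t 1 = modelFun ε (T.model i) (T.chartPath t 0) :=
  (mem_standardStrand.1 (T.chartPath_mem ht)).2

theorem exists_chartPath_eq {p : Plane} (hp : p ∈ standardStrand ε (T.model i)) :
    ∃ t ∈ T.inside i, T.chartPath t = p := by
  have hb := (mem_standardStrand.1 hp).1
  have e := T.chart.toHomeo.right_inv (T.chart.closedBall_subset_target hb)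
  have h : T.chart.toHomeo.symm p ∈ k.path '' T.inside i := by
    unfold inside
    rw [T.image_strand i]
    refine ⟨T.chart.symm_mem hb, ?_⟩
    rw [mem_preimage, e]
    exact hp
  obtain ⟨t, ht, h⟩ := h
  exact ⟨t, ht, by rw [chartPath, h, e]⟩

theorem hasDerivAt_chartPath (h : k.path t ∈ C) : HasDerivAt T.chartPath (T.chartVelocity t) t :=
  (T.chart.hasFDerivAt (T.chart.subset_source h)).comp_hasDerivAt t (k.hasDerivAt_path t)

theorem hasDerivAt_chartPath_apply (h : k.path t ∈ C) (n : Fin 2) :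
    HasDerivAt (fun t => T.chartPath t n) (T.chartVelocity t n) t :=
  (EuclideanSpace.proj (𝕜 := ℝ) n).hasFDerivAt.comp_hasDerivAt t (T.hasDerivAt_chartPath h)

theorem uniqueDiffWithinAt (ht : t ∈ T.inside i) : UniqueDiffWithinAt ℝ (T.inside i) t :=
  uniqueDiffOn_Icc (T.start_lt_finish i) t ht

theorem chartVelocity_one (ht : t ∈ T.inside i) :
    T.chartVelocity t 1 = modelSlope ε (T.model i) (T.chartPath t 0) * T.chartVelocity t 0 := by
  have h1 := (T.hasDerivAt_chartPath_apply (T.path_mem ht) 1).hasDerivWithinAt (s := T.inside i)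
  have h2 := ((hasDerivAt_modelFun ε (T.model i) (T.chartPath t 0)).comp t
    (T.hasDerivAt_chartPath_apply (T.path_mem ht) 0)).hasDerivWithinAt (s := T.inside i)
  exact (T.uniqueDiffWithinAt ht).eq_deriv _ h1
    (h2.congr (fun u hu => T.chartPath_one hu) (T.chartPath_one ht))

theorem chartVelocity_zero_ne (ht : t ∈ T.inside i) : T.chartVelocity t 0 ≠ 0 := by
  intro h
  refine T.chart.fderiv_ne_zero (T.chart.subset_source (T.path_mem ht)) (k.deriv_path_ne_zero t) ?_
  refine plane_ext h ?_
  rw [← chartVelocity, T.chartVelocity_one ht, h, mul_zero, PiLp.zero_apply]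

theorem direction_mul_chartVelocity_pos (ht : t ∈ T.inside i) :
    0 < T.direction i * T.chartVelocity t 0 := by
  have hsign := hasDerivWithinAt_forall_lt_or_forall_gt_of_forall_ne
    (convex_Icc (T.start i) (T.finish i))
    (fun u hu => (T.hasDerivAt_chartPath_apply (T.path_mem (i := i) hu) 0).hasDerivWithinAt)
    (fun u hu => T.chartVelocity_zero_ne (i := i) hu)
  unfold direction
  rcases hsign with hneg | hpos
  · rw [if_neg (hneg _ (T.start_mem i)).le.not_gt]
    push_cast
    linarith [hneg _ ht]
  · rw [if_pos (hpos _ (T.start_mem i))]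
    push_cast
    linarith [hpos _ ht]

theorem sign_chartVelocity_zero (ht : t ∈ T.inside i) :
    (SignType.sign (T.chartVelocity t 0) : ℤ) = T.direction i := by
  have hpos := T.direction_mul_chartVelocity_pos ht
  rcases T.direction_eq i with h | h <;> rw [h] at hpos ⊢ <;> push_cast at hpos
  exacts [coe_sign_of_pos (by linarith), coe_sign_of_neg (by linarith)]

theorem strictMonoOn_chartPath_zero (i : Fin 3) :
    StrictMonoOn (fun t => T.direction i * T.chartPath t 0) (T.inside i) := by
  refine strictMonoOn_of_deriv_pos (convex_Icc _ _) (fun u hu => ?_) fun u hu => ?_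
  · exact ((T.hasDerivAt_chartPath_apply (T.path_mem (i := i) hu) 0).const_mul
      (T.direction i : ℝ)).continuousAt.continuousWithinAt
  · have hu' : u ∈ T.inside i := interior_subset hu
    rw [((T.hasDerivAt_chartPath_apply (T.path_mem hu') 0).const_mul (T.direction i : ℝ)).deriv]
    exact T.direction_mul_chartVelocity_pos hu'

theorem injOn_chartPath_zero (i : Fin 3) : InjOn (fun t => T.chartPath t 0) (T.inside i) :=
  fun _ hs _ ht h => (T.strictMonoOn_chartPath_zero i).injOn hs ht (by simpa using Or.inl h)

theorem injOn_path (i : Fin 3) : InjOn k.path (T.inside i) :=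
  fun _ hs _ ht h => T.injOn_chartPath_zero i hs ht (by simp only [chartPath, h])

theorem path_eq_iff_chartPath_eq (hs : s ∈ T.inside i) (ht : t ∈ T.inside j) :
    k.path s = k.path t ↔ T.chartPath s = T.chartPath t :=
  (T.chart.injOn.eq_iff (T.path_mem hs) (T.path_mem ht)).symm

theorem chartPath_sq_add_sq_le (ht : t ∈ T.inside i) :
    T.chartPath t 0 ^ 2 + T.chartPath t 1 ^ 2 ≤ 1 :=
  plane_mem_closedBall.1 (mem_standardStrand.1 (T.chartPath_mem ht)).1

theorem chartPath_zero_mem (hε : ε ^ 2 = 1) (ht : t ∈ T.inside i) :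
    T.chartPath t 0 ∈ Icc (-modelEnd (T.model i)) (modelEnd (T.model i)) := by
  rw [← sq_add_modelFun_sq_le_one_iff hε, ← T.chartPath_one ht]
  exact T.chartPath_sq_add_sq_le ht

theorem exists_chartPath_zero_eq (hε : ε ^ 2 = 1) {x : ℝ}
    (hx : x ∈ Icc (-modelEnd (T.model i)) (modelEnd (T.model i))) :
    ∃ t ∈ T.inside i, T.chartPath t 0 = x := by
  have hp : !₂[x, modelFun ε (T.model i) x] ∈ standardStrand ε (T.model i) := by
    rw [mem_standardStrand, plane_mem_closedBall]
    exact ⟨(sq_add_modelFun_sq_le_one_iff hε _ _).2 hx, rfl⟩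
  obtain ⟨t, ht, h⟩ := T.exists_chartPath_eq hp
  exact ⟨t, ht, by rw [h]; rfl⟩

theorem crossParam_spec (hε : ε ^ 2 = 1) (i j : Fin 3) : T.crossParam i j ∈ T.inside i ∧
    T.chartPath (T.crossParam i j) 0 = modelCross ε (T.model i) (T.model j) :=
  Function.invFunOn_pos <| T.exists_chartPath_zero_eq hε <|
    Ioo_subset_Icc_self (modelCross_mem hε _ _)

theorem crossParam_mem (hε : ε ^ 2 = 1) (i j : Fin 3) : T.crossParam i j ∈ T.inside i :=
  (T.crossParam_spec hε i j).1

theorem chartPath_crossParam_zero (hε : ε ^ 2 = 1) (i j : Fin 3) :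
    T.chartPath (T.crossParam i j) 0 = modelCross ε (T.model i) (T.model j) :=
  (T.crossParam_spec hε i j).2

theorem path_eq_iff (hε : ε ^ 2 = 1) (hij : i ≠ j) (hs : s ∈ T.inside i) (ht : t ∈ T.inside j) :
    k.path s = k.path t ↔ s = T.crossParam i j ∧ t = T.crossParam j i := by
  have hm : T.model i ≠ T.model j := T.model.injective.ne hij
  rw [T.path_eq_iff_chartPath_eq hs ht]
  constructor
  · intro h
    have h0 : T.chartPath s 0 = modelCross ε (T.model i) (T.model j) := by
      rw [← modelFun_eq_iff hε hm (T.chartPath_zero_mem hε hs), ← T.chartPath_one hs, h,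
        ← T.chartPath_one ht]
    refine ⟨T.injOn_chartPath_zero i hs (T.crossParam_mem hε i j) ?_,
      T.injOn_chartPath_zero j ht (T.crossParam_mem hε j i) ?_⟩
    · exact h0.trans (T.chartPath_crossParam_zero hε i j).symm
    · change T.chartPath t 0 = T.chartPath (T.crossParam j i) 0
      rw [← h, h0, T.chartPath_crossParam_zero hε, modelCross_comm]
  · rintro ⟨rfl, rfl⟩
    have e : T.chartPath (T.crossParam j i) 0 = T.chartPath (T.crossParam i j) 0 := by
      rw [T.chartPath_crossParam_zero hε, T.chartPath_crossParam_zero hε, modelCross_comm]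
    refine plane_ext e.symm ?_
    rw [T.chartPath_one hs, T.chartPath_one ht, e,
      modelFun_eq_iff hε hm (T.chartPath_zero_mem hε hs),
      T.chartPath_crossParam_zero hε]

theorem path_crossParam (hε : ε ^ 2 = 1) (hij : i ≠ j) :
    k.path (T.crossParam i j) = k.path (T.crossParam j i) :=
  (T.path_eq_iff hε hij (T.crossParam_mem hε i j) (T.crossParam_mem hε j i)).2 ⟨rfl, rfl⟩

theorem direction_mul_mem_Icc (i : Fin 3) {x r : ℝ} (hx : x ∈ Icc (-r) r) :
    T.direction i * x ∈ Icc (-r) r := by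
  rcases T.direction_eq i with h | h <;> rw [h] <;> push_cast <;>
    constructor <;> linarith [hx.1, hx.2]

theorem chartPath_start_zero (hε : ε ^ 2 = 1) (i : Fin 3) :
    T.chartPath (T.start i) 0 = -(T.direction i * modelEnd (T.model i)) := by
  have hend := modelEnd_pos (T.model i)
  obtain ⟨t, ht, hx⟩ := T.exists_chartPath_zero_eq hε
    (T.direction_mul_mem_Icc i (left_mem_Icc.2 (by linarith)))
  have hle := (T.strictMonoOn_chartPath_zero i).monotoneOn (T.start_mem i) ht ht.1
  have hge := (T.direction_mul_mem_Icc i (T.chartPath_zero_mem hε (T.start_mem i))).1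
  simp only [hx, ← mul_assoc, T.direction_mul_self, one_mul] at hle
  linear_combination T.direction i * hle.antisymm hge -
    T.chartPath (T.start i) 0 * T.direction_mul_self i

theorem chartPath_finish_zero (hε : ε ^ 2 = 1) (i : Fin 3) :
    T.chartPath (T.finish i) 0 = T.direction i * modelEnd (T.model i) := by
  have hend := modelEnd_pos (T.model i)
  obtain ⟨t, ht, hx⟩ := T.exists_chartPath_zero_eq hε
    (T.direction_mul_mem_Icc i (right_mem_Icc.2 (by linarith)))
  have hge := (T.strictMonoOn_chartPath_zero i).monotoneOn ht (T.finish_mem i) ht.2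
  have hle := (T.direction_mul_mem_Icc i (T.chartPath_zero_mem hε (T.finish_mem i))).2
  simp only [hx, ← mul_assoc, T.direction_mul_self, one_mul] at hge
  linear_combination T.direction i * hle.antisymm hge -
    T.chartPath (T.finish i) 0 * T.direction_mul_self i

theorem chartPath_sq_add_sq_of_end (hε : ε ^ 2 = 1) (ht : t = T.start i ∨ t = T.finish i) :
    T.chartPath t 0 ^ 2 + T.chartPath t 1 ^ 2 = 1 := by
  have hmem : t ∈ T.inside i := by
    rcases ht with rfl | rfl
    exacts [T.start_mem i, T.finish_mem i]
  rw [T.chartPath_one hmem]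
  apply sq_add_modelFun_sq_eq_one hε
  rcases ht with rfl | rfl
  · rw [T.chartPath_start_zero hε]
    linear_combination modelEnd (T.model i) ^ 2 * T.direction_mul_self i
  · rw [T.chartPath_finish_zero hε]
    linear_combination modelEnd (T.model i) ^ 2 * T.direction_mul_self i

theorem crossParam_ne_end (hε : ε ^ 2 = 1) (i j : Fin 3) :
    T.crossParam i j ≠ T.start i ∧ T.crossParam i j ≠ T.finish i := by
  have hcross := modelCross_mem hε (T.model i) (T.model j)
  rw [← T.chartPath_crossParam_zero hε] at hcross
  constructor <;> intro h <;> rw [h] at hcross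
  · rw [T.chartPath_start_zero hε] at hcross
    rcases T.direction_eq i with h' | h' <;> rw [h'] at hcross <;> push_cast at hcross <;>
      linarith [hcross.1, hcross.2]
  · rw [T.chartPath_finish_zero hε] at hcross
    rcases T.direction_eq i with h' | h' <;> rw [h'] at hcross <;> push_cast at hcross <;>
      linarith [hcross.1, hcross.2]

theorem sign_planeDet_crossParam (hε : ε ^ 2 = 1) (hij : i ≠ j) :
    (SignType.sign
      (planeDet (deriv k.path (T.crossParam i j)) (deriv k.path (T.crossParam j i))) : ℤ) =
      T.direction i * T.direction j * modelSign (T.model i) (T.model j) := by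
  have hi := T.crossParam_mem hε i j
  have hj := T.crossParam_mem hε j i
  have hvi := T.chartVelocity_one hi
  have hvj := T.chartVelocity_one hj
  rw [T.chartPath_crossParam_zero hε] at hvi hvj
  rw [modelCross_comm] at hvj
  have hdet : planeDet (T.chartVelocity (T.crossParam i j)) (T.chartVelocity (T.crossParam j i)) =
      T.chartVelocity (T.crossParam i j) 0 * T.chartVelocity (T.crossParam j i) 0 *
        (modelSlope ε (T.model j) (modelCross ε (T.model i) (T.model j)) -
          modelSlope ε (T.model i) (modelCross ε (T.model i) (T.model j))) := by
    rw [planeDet, hvi, hvj]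
    ring
  rw [← T.chart.sign_planeDet_fderiv (T.chart.subset_source (T.path_mem hi)), ← chartVelocity,
    T.path_crossParam hε hij, ← chartVelocity, hdet, sign_mul, sign_mul, SignType.coe_mul,
    SignType.coe_mul, T.sign_chartVelocity_zero hi, T.sign_chartVelocity_zero hj,
    sign_modelSlope hε (T.model.injective.ne hij)]

theorem model_add_sub (i : Fin 3) :
    (T.cyclicParity = 1 ∧ T.model (i + 1) = T.model i + 1 ∧ T.model (i - 1) = T.model i - 1) ∨
    (T.cyclicParity = -1 ∧ T.model (i + 1) = T.model i - 1 ∧ T.model (i - 1) = T.model i + 1) := by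
  unfold cyclicParity
  generalize T.model = e
  revert e i
  decide

/-- The sign of an edge of the triangle, which for `ε = 1` tells whether its two orientations
coincide. -/
def edgeSign (i : Fin 3) : ℤ := T.direction i * T.cyclicParity * modelOrder (T.model i)

theorem edgeSign_eq (i : Fin 3) : T.edgeSign i = 1 ∨ T.edgeSign i = -1 := by
  have horder : modelOrder (T.model i) = 1 ∨ modelOrder (T.model i) = -1 := by
    generalize T.model i = m
    revert m; decide
  unfold edgeSign
  rcases T.direction_eq i with h | h <;> rcases T.cyclicParity_eq with h' | h' <;>
    rcases horder with h'' | h'' <;> simp [h, h', h'']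

theorem sign_mul_crossParam_sub (hε : ε ^ 2 = 1) (i : Fin 3) :
    (SignType.sign (ε * (T.crossParam i (i + 1) - T.crossParam i (i - 1))) : ℤ) =
      T.edgeSign i := by
  have hsub : ∀ s ∈ T.inside i, ∀ t ∈ T.inside i, SignType.sign (s - t) =
      SignType.sign (T.direction i * (T.chartPath s 0 - T.chartPath t 0)) := by
    intro s hs t ht
    have hmono := T.strictMonoOn_chartPath_zero i
    rcases lt_trichotomy s t with h | rfl | h
    · have := hmono hs ht h
      rw [sign_neg (sub_neg.2 h), sign_neg (by linarith)]
    · simp only [sub_self, mul_zero]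
    · have := hmono ht hs h
      rw [sign_pos (sub_pos.2 h), sign_pos (by linarith)]
  have hparity : modelCross ε (T.model i) (T.model (i + 1)) -
      modelCross ε (T.model i) (T.model (i - 1)) = T.cyclicParity *
        (modelCross ε (T.model i) (T.model i + 1) - modelCross ε (T.model i) (T.model i - 1)) := by
    rcases T.model_add_sub i with ⟨h, hp, hm⟩ | ⟨h, hp, hm⟩ <;> rw [h, hp, hm] <;> push_cast <;>
      ring
  have hcast : ∀ n : ℤ, n = 1 ∨ n = -1 → (SignType.sign (n : ℝ) : ℤ) = n := by
    rintro n (rfl | rfl)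
    exacts [coe_sign_of_pos (by norm_num), coe_sign_of_neg (by norm_num)]
  rw [sign_mul, hsub _ (T.crossParam_mem hε _ _) _ (T.crossParam_mem hε _ _),
    T.chartPath_crossParam_zero hε, T.chartPath_crossParam_zero hε, hparity, ← sign_mul,
    mul_left_comm, mul_left_comm ε, ← mul_assoc, sign_mul, sign_mul, SignType.coe_mul,
    SignType.coe_mul, hcast _ (T.direction_eq i), hcast _ T.cyclicParity_eq, sign_modelCross hε,
    edgeSign]

theorem crossParam_lt_crossParam_iff (hε : ε ^ 2 = 1) (i : Fin 3) :
    T.crossParam i (i - 1) < T.crossParam i (i + 1) ↔ 0 < ε * T.edgeSign i := by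
  rw [← T.sign_mul_crossParam_sub hε, ← sub_pos]
  generalize T.crossParam i (i + 1) - T.crossParam i (i - 1) = d
  rcases sq_eq_one_iff.1 hε with rfl | rfl <;> rcases lt_trichotomy d 0 with h | rfl | h
  · simp [sign_neg h, h.not_gt]
  · simp
  · simp [sign_pos h, h]
  · simp [sign_pos (neg_pos.2 h), h.not_gt]
  · simp
  · simp [sign_neg (neg_neg_iff_pos.2 h), h]

theorem crossParam_ne_crossParam (hε : ε ^ 2 = 1) (i : Fin 3) :
    T.crossParam i (i - 1) ≠ T.crossParam i (i + 1) := by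
  intro h
  have hsign := T.sign_mul_crossParam_sub hε i
  rw [h, sub_self, mul_zero, sign_zero, SignType.coe_zero] at hsign
  rcases T.edgeSign_eq i with h' | h' <;> omega

theorem crossParam_lt_crossParam_iff_not (hε : ε ^ 2 = 1) (i : Fin 3) :
    T.crossParam i (i + 1) < T.crossParam i (i - 1) ↔ ¬ 0 < ε * T.edgeSign i := by
  rw [← T.crossParam_lt_crossParam_iff hε, not_lt,
    (T.crossParam_ne_crossParam hε i).symm.le_iff_lt]

theorem edgeCoincides_iff (hε : ε ^ 2 = 1) (i : Fin 3) :
    T.EdgeCoincides i ↔ T.crossParam i (i - 1) < T.crossParam i (i + 1) := by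
  have hsub : i ≠ i - 1 := by revert i; decide
  have hadd : i ≠ i + 1 := by revert i; decide
  constructor
  · rintro ⟨s, hs, t, ht, hst, ⟨s', hs', hss'⟩, ⟨t', ht', htt'⟩⟩
    rw [← ((T.path_eq_iff hε hsub hs hs').1 hss'.symm).1,
      ← ((T.path_eq_iff hε hadd ht ht').1 htt'.symm).1]
    exact hst
  · intro h
    exact ⟨_, T.crossParam_mem hε _ _, _, T.crossParam_mem hε _ _, h,
      ⟨_, T.crossParam_mem hε _ _, (T.path_crossParam hε hsub).symm⟩,
      ⟨_, T.crossParam_mem hε _ _, (T.path_crossParam hε hadd).symm⟩⟩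

end ThreeStrands

/-! ### The division of the circle into six regions -/

/-- The region of the `i`-th strand inside the changing disk. The inside and the exterior strands
alternate along the circle, hence the even numbers. -/
def insideRegion : Fin 3 → Fin 6 := ![0, 2, 4]

/-- The region of the `i`-th exterior strand, which follows that of the `i`-th inside strand. -/
def exteriorRegion : Fin 3 → Fin 6 := ![1, 3, 5]

theorem insideRegion_ne_exteriorRegion (i j : Fin 3) : insideRegion i ≠ exteriorRegion j := by
  revert i j; decide

theorem insideRegion_injective : Function.Injective insideRegion := by decide

theorem exteriorRegion_injective : Function.Injective exteriorRegion := by decide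

theorem eq_insideRegion_or_eq_exteriorRegion (n : Fin 6) :
    (∃ i, n = insideRegion i) ∨ ∃ i, n = exteriorRegion i := by
  revert n; decide

section Monotone

variable {α β : Type*} [LinearOrder α] {f : α → β} {a b c d : α}

theorem CyclicLt.cyclicLe_map [Preorder β] (hf : Monotone f) (h : CyclicLt a b c d) :
    CyclicLe (f a) (f b) (f c) (f d) := by
  rcases h with h | h | h | h
  · exact Or.inl ⟨hf h.1.le, hf h.2.1.le, hf h.2.2.le⟩
  · exact Or.inr (Or.inl ⟨hf h.1.le, hf h.2.1.le, hf h.2.2.le⟩)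
  · exact Or.inr (Or.inr (Or.inl ⟨hf h.1.le, hf h.2.1.le, hf h.2.2.le⟩))
  · exact Or.inr (Or.inr (Or.inr ⟨hf h.1.le, hf h.2.1.le, hf h.2.2.le⟩))

theorem cyclicLt_map_iff [LinearOrder β] (hf : Monotone f) (hab : f a ≠ f b) (hbc : f b ≠ f c)
    (hcd : f c ≠ f d) (hda : f d ≠ f a) :
    CyclicLt (f a) (f b) (f c) (f d) ↔ CyclicLt a b c d := by
  have hlt : ∀ {x y : α}, f x ≠ f y → (f x < f y ↔ x < y) := fun h =>
    ⟨fun h' => hf.reflect_lt h', fun h' => (hf h'.le).lt_of_ne h⟩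
  unfold CyclicLt
  rw [hlt hab, hlt hbc, hlt hcd, hlt hda]

end Monotone

namespace ThreeStrands

variable {k : KnotDiagram} {C : Set Plane} {ε : ℝ} (T : ThreeStrands k C ε)

/-- The region of a parameter in `[T.start 0, T.start 0 + 1)`. -/
def region (t : ℝ) : Fin 6 :=
  if t ≤ T.finish 0 then 0 else if t < T.start 1 then 1 else if t ≤ T.finish 1 then 2 else
    if t < T.start 2 then 3 else if t ≤ T.finish 2 then 4 else 5

/-- The region of a point of the circle. -/
def regionOf (p : Pt Unit) : Fin 6 := T.region (rep (T.start 0) p)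

variable {i j : Fin 3} {t : ℝ}

theorem region_monotone : Monotone T.region := by
  have := T.finish_zero_lt
  have := T.start_lt_finish 1
  have := T.finish_one_lt
  have := T.start_lt_finish 2
  intro s t hst
  unfold region
  split_ifs <;> first | decide | (exfalso; linarith)

theorem nextStart_eq (i : Fin 3) :
    T.nextStart i = if i = 2 then T.start 0 + 1 else T.start (i + 1) := by
  fin_cases i <;> rfl

theorem finish_lt_nextStart (i : Fin 3) : T.finish i < T.nextStart i := by
  fin_cases i
  exacts [T.finish_zero_lt, T.finish_one_lt, T.finish_two_lt]

theorem start_zero_le_start (i : Fin 3) : T.start 0 ≤ T.start i := by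
  have := T.start_lt_finish 0
  have := T.finish_zero_lt
  have := T.start_lt_finish 1
  have := T.finish_one_lt
  fin_cases i
  exacts [le_rfl, by change T.start 0 ≤ T.start 1; linarith,
    by change T.start 0 ≤ T.start 2; linarith]

theorem nextStart_le_start_zero_add_one (i : Fin 3) : T.nextStart i ≤ T.start 0 + 1 := by
  have := T.start_lt_finish 1
  have := T.finish_one_lt
  have := T.start_lt_finish 2
  have := T.finish_two_lt
  fin_cases i
  exacts [by change T.start 1 ≤ _; linarith, by change T.start 2 ≤ _; linarith, le_rfl]

theorem inside_subset (i : Fin 3) : T.inside i ⊆ Ico (T.start 0) (T.start 0 + 1) := fun _ ht =>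
  ⟨(T.start_zero_le_start i).trans ht.1,
    (ht.2.trans_lt (T.finish_lt_nextStart i)).trans_le (T.nextStart_le_start_zero_add_one i)⟩

theorem exterior_subset (i : Fin 3) :
    Ioo (T.finish i) (T.nextStart i) ⊆ Ico (T.start 0) (T.start 0 + 1) := fun _ ht =>
  ⟨(T.start_zero_le_start i).trans ((T.start_lt_finish i).trans ht.1).le,
    ht.2.trans_le (T.nextStart_le_start_zero_add_one i)⟩

theorem region_eq_insideRegion_iff (ht : t ∈ Ico (T.start 0) (T.start 0 + 1)) :
    T.region t = insideRegion i ↔ t ∈ T.inside i := by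
  have := T.start_lt_finish 0
  have := T.finish_zero_lt
  have := T.start_lt_finish 1
  have := T.finish_one_lt
  have := T.start_lt_finish 2
  have := ht.1
  unfold region inside
  rw [mem_Icc]
  fin_cases i <;> simp only [insideRegion] <;> split_ifs <;> simp <;> grind

theorem region_eq_exteriorRegion_iff (ht : t ∈ Ico (T.start 0) (T.start 0 + 1)) :
    T.region t = exteriorRegion i ↔ t ∈ Ioo (T.finish i) (T.nextStart i) := by
  have := T.finish_zero_lt
  have := T.start_lt_finish 1
  have := T.finish_one_lt
  have := T.start_lt_finish 2
  have := ht.2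
  unfold region nextStart
  rw [mem_Ioo]
  fin_cases i <;> simp only [exteriorRegion] <;> split_ifs <;> simp <;> grind

theorem regionOf_pt_of_mem_inside (ht : t ∈ T.inside i) :
    T.regionOf (pt () t) = insideRegion i := by
  have ht' := T.inside_subset i ht
  rwa [regionOf, rep_pt () ht', T.region_eq_insideRegion_iff ht']

theorem regionOf_pt_of_mem_exterior (ht : t ∈ Ioo (T.finish i) (T.nextStart i)) :
    T.regionOf (pt () t) = exteriorRegion i := by
  have ht' := T.exterior_subset i ht
  rwa [regionOf, rep_pt () ht', T.region_eq_exteriorRegion_iff ht']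

theorem exists_of_regionOf_eq_insideRegion {p : Pt Unit} (h : T.regionOf p = insideRegion i) :
    ∃ t ∈ T.inside i, p = pt () t :=
  ⟨_, (T.region_eq_insideRegion_iff (rep_mem _ p)).1 h, (pt_rep_unit _ p).symm⟩

theorem exists_of_regionOf_eq_exteriorRegion {p : Pt Unit}
    (h : T.regionOf p = exteriorRegion i) :
    ∃ t ∈ Ioo (T.finish i) (T.nextStart i), p = pt () t :=
  ⟨_, (T.region_eq_exteriorRegion_iff (rep_mem _ p)).1 h, (pt_rep_unit _ p).symm⟩

theorem path_notMem (ht : t ∈ Ioo (T.finish i) (T.nextStart i)) : k.path t ∉ C :=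
  T.notMem_exterior i t ht

theorem cyclicLe_regionOf {x y : Arrow Unit} (h : Follows (T.start 0) x y) :
    CyclicLe (T.regionOf x.1) (T.regionOf y.1) (T.regionOf x.2) (T.regionOf y.2) :=
  CyclicLt.cyclicLe_map (f := T.region) T.region_monotone h

theorem follows_iff_cyclicLt_regionOf {x y : Arrow Unit} (h₁ : T.regionOf x.1 ≠ T.regionOf y.1)
    (h₂ : T.regionOf y.1 ≠ T.regionOf x.2) (h₃ : T.regionOf x.2 ≠ T.regionOf y.2)
    (h₄ : T.regionOf y.2 ≠ T.regionOf x.1) : Follows (T.start 0) x y ↔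
      CyclicLt (T.regionOf x.1) (T.regionOf y.1) (T.regionOf x.2) (T.regionOf y.2) :=
  (cyclicLt_map_iff T.region_monotone h₁ h₂ h₃ h₄).symm

/-! ### The arrows at the changing disk -/

/-- The preimage on the strand `i` of the crossing of the strands `i` and `j`. -/
def crossPt (i j : Fin 3) : Pt Unit := pt () (T.crossParam i j)

/-- The arrow from the strand `i` to the strand `j`. -/
def arrow (i j : Fin 3) : Arrow Unit := (T.crossPt i j, T.crossPt j i)

/-- The number of the top strand. -/
def top : Fin 3 := T.height.symm 2

/-- The number of the middle strand. -/
def mid : Fin 3 := T.height.symm 1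

/-- The number of the bottom strand. -/
def bot : Fin 3 := T.height.symm 0

/-- The tail and the head of the arrow `x` are on the exterior strands. -/
def IsExterior (x : Arrow Unit) : Prop :=
  (∃ i, T.regionOf x.1 = exteriorRegion i) ∧ ∃ j, T.regionOf x.2 = exteriorRegion j

theorem top_ne_mid : T.top ≠ T.mid := T.height.symm.injective.ne (by decide)

theorem mid_ne_bot : T.mid ≠ T.bot := T.height.symm.injective.ne (by decide)

theorem top_ne_bot : T.top ≠ T.bot := T.height.symm.injective.ne (by decide)

theorem regionOf_crossPt (hε : ε ^ 2 = 1) (i j : Fin 3) :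
    T.regionOf (T.crossPt i j) = insideRegion i :=
  T.regionOf_pt_of_mem_inside (T.crossParam_mem hε i j)

theorem rep_crossPt (hε : ε ^ 2 = 1) (i j : Fin 3) :
    rep (T.start 0) (T.crossPt i j) = T.crossParam i j :=
  rep_pt () (T.inside_subset i (T.crossParam_mem hε i j))

theorem crosses_crossPt (hε : ε ^ 2 = 1) (hij : i ≠ j) :
    k.Crosses (T.crossPt i j) (T.crossPt j i) := by
  refine k.crosses_iff.2 ⟨fun h => hij (insideRegion_injective ?_), T.path_crossParam hε hij⟩
  rw [← T.regionOf_crossPt hε i j, ← T.regionOf_crossPt hε j i]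
  exact congrArg _ h

theorem arrow_mem_arrows_iff (hε : ε ^ 2 = 1) (hij : i ≠ j) :
    T.arrow i j ∈ k.gaussDiagram.arrows ↔ T.height j < T.height i := by
  rw [k.mem_arrows, ← T.over_iff_height i j hij _ (T.crossParam_mem hε i j) _
    (T.crossParam_mem hε j i) (T.path_crossParam hε hij)]
  exact and_iff_right (T.crosses_crossPt hε hij)

theorem arrow_top_mid_mem_arrows (hε : ε ^ 2 = 1) :
    T.arrow T.top T.mid ∈ k.gaussDiagram.arrows :=
  (T.arrow_mem_arrows_iff hε T.top_ne_mid).2 (by simp [top, mid])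

theorem arrow_mid_bot_mem_arrows (hε : ε ^ 2 = 1) :
    T.arrow T.mid T.bot ∈ k.gaussDiagram.arrows :=
  (T.arrow_mem_arrows_iff hε T.mid_ne_bot).2 (by simp [mid, bot])

theorem not_isExterior_arrow (hε : ε ^ 2 = 1) (i j : Fin 3) : ¬ T.IsExterior (T.arrow i j) := by
  rintro ⟨⟨u, hu⟩, -⟩
  exact insideRegion_ne_exteriorRegion i u ((T.regionOf_crossPt hε i j).symm.trans hu)

theorem arrow_eq_arrow_iff (hε : ε ^ 2 = 1) {i' j' : Fin 3} :
    T.arrow i j = T.arrow i' j' ↔ i = i' ∧ j = j' := by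
  refine ⟨fun h => ?_, by rintro ⟨rfl, rfl⟩; rfl⟩
  have htail := congrArg (fun x : Arrow Unit => T.regionOf x.1) h
  have hhead := congrArg (fun x : Arrow Unit => T.regionOf x.2) h
  simp only [arrow, T.regionOf_crossPt hε] at htail hhead
  exact ⟨insideRegion_injective htail, insideRegion_injective hhead⟩

theorem arrow_top_mid_ne_arrow_mid_bot (hε : ε ^ 2 = 1) :
    T.arrow T.top T.mid ≠ T.arrow T.mid T.bot :=
  fun h => T.top_ne_mid ((T.arrow_eq_arrow_iff hε).1 h).1

theorem crosses_cases (hε : ε ^ 2 = 1) {p q : Pt Unit} (h : k.Crosses p q) :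
    (∃ i j, i ≠ j ∧ p = T.crossPt i j ∧ q = T.crossPt j i) ∨
      (∃ i, T.regionOf p = exteriorRegion i) ∧ ∃ j, T.regionOf q = exteriorRegion j := by
  rcases eq_insideRegion_or_eq_exteriorRegion (T.regionOf p) with ⟨i, hi⟩ | ⟨i, hi⟩
  · obtain ⟨s, hs, rfl⟩ := T.exists_of_regionOf_eq_insideRegion hi
    rcases eq_insideRegion_or_eq_exteriorRegion (T.regionOf q) with ⟨j, hj⟩ | ⟨j, hj⟩
    · obtain ⟨t, ht, rfl⟩ := T.exists_of_regionOf_eq_insideRegion hj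
      obtain ⟨hne, heq⟩ := k.crosses_iff.1 h
      have hij : i ≠ j := by
        rintro rfl
        exact hne (congrArg _ (T.injOn_path i hs ht heq))
      obtain ⟨rfl, rfl⟩ := (T.path_eq_iff hε hij hs ht).1 heq
      exact Or.inl ⟨i, j, hij, rfl, rfl⟩
    · obtain ⟨t, ht, rfl⟩ := T.exists_of_regionOf_eq_exteriorRegion hj
      exact absurd ((k.crosses_iff.1 h).2 ▸ T.path_mem hs) (T.path_notMem ht)
  · obtain ⟨s, hs, rfl⟩ := T.exists_of_regionOf_eq_exteriorRegion hi
    rcases eq_insideRegion_or_eq_exteriorRegion (T.regionOf q) with ⟨j, hj⟩ | ⟨j, hj⟩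
    · obtain ⟨t, ht, rfl⟩ := T.exists_of_regionOf_eq_insideRegion hj
      exact absurd ((k.crosses_iff.1 h).2.symm ▸ T.path_mem ht) (T.path_notMem hs)
    · exact Or.inr ⟨⟨i, hi⟩, ⟨j, hj⟩⟩

theorem exists_eq_arrow_or_isExterior (hε : ε ^ 2 = 1) {x : Arrow Unit}
    (hx : x ∈ k.gaussDiagram.arrows) :
    (∃ i j, i ≠ j ∧ x = T.arrow i j) ∨ T.IsExterior x :=
  (T.crosses_cases hε ((k.mem_arrows x).1 hx).1).imp_left fun ⟨i, j, hij, htail, hhead⟩ =>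
    ⟨i, j, hij, Prod.ext htail hhead⟩

theorem mem_arrows_cases (hε : ε ^ 2 = 1) {x : Arrow Unit} (hx : x ∈ k.gaussDiagram.arrows) :
    x = T.arrow T.top T.mid ∨ x = T.arrow T.mid T.bot ∨ x = T.arrow T.top T.bot ∨
      T.IsExterior x := by
  rcases T.exists_eq_arrow_or_isExterior hε hx with ⟨i, j, hij, rfl⟩ | h
  · have hheight := (T.arrow_mem_arrows_iff hε hij).1 hx
    have hcases : i = T.top ∧ j = T.mid ∨ i = T.mid ∧ j = T.bot ∨ i = T.top ∧ j = T.bot := by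
      unfold top mid bot
      generalize T.height = e at hheight
      clear hx hij
      revert e i j
      decide
    rcases hcases with ⟨rfl, rfl⟩ | ⟨rfl, rfl⟩ | ⟨rfl, rfl⟩ <;> simp only [true_or, or_true]
  · exact Or.inr (Or.inr (Or.inr h))

/-! ### Cyclic triples of arrows at the changing disk -/

-- The ends of `z` separate the tails of its two neighbours, and their heads too, but they do not
-- separate points on the same strand inside the disk.
theorem ne_and_ne_of_follows_arrow (hε : ε ^ 2 = 1) {i' j' : Fin 3} {z : Arrow Unit}
    (hz : T.IsExterior z) (h : Follows (T.start 0) (T.arrow i j) z)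
    (h' : Follows (T.start 0) z (T.arrow i' j')) : i ≠ i' ∧ j ≠ j' := by
  obtain ⟨⟨u, hu⟩, ⟨v, hv⟩⟩ := hz
  replace h := T.cyclicLe_regionOf h
  replace h' := T.cyclicLe_regionOf h'
  simp only [arrow, T.regionOf_crossPt hε, hu, hv] at h h'
  clear hu hv
  revert i j i' j' u v
  decide

theorem isExterior_or_isExterior_of_follows (hε : ε ^ 2 = 1) {x y z : Arrow Unit}
    (hxyz : ({x, y, z} : Set (Arrow Unit)) ⊆ k.gaussDiagram.arrows)
    (hnot : ¬ ({T.arrow T.top T.mid, T.arrow T.mid T.bot} : Set (Arrow Unit)) ⊆ {x, y, z})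
    (hxy : Follows (T.start 0) x y) (hyz : Follows (T.start 0) y z)
    (hzx : Follows (T.start 0) z x) : T.IsExterior x ∨ T.IsExterior y := by
  by_contra! hinside
  have hne_xy : x ≠ y := by rintro rfl; exact not_follows_self _ _ hxy
  have hne_yz : y ≠ z := by rintro rfl; exact not_follows_self _ _ hyz
  have hne_zx : z ≠ x := by rintro rfl; exact not_follows_self _ _ hzx
  simp only [insert_subset_iff, singleton_subset_iff, mem_insert_iff, mem_singleton_iff,
    Finset.mem_coe] at hxyz hnot
  have hx := T.mem_arrows_cases hε hxyz.1
  have hy := T.mem_arrows_cases hε hxyz.2.1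
  have hz : T.IsExterior z := by
    have := T.mem_arrows_cases hε hxyz.2.2
    grind
  have hsep : ∀ i j i' j', y = T.arrow i j → x = T.arrow i' j' → i ≠ i' ∧ j ≠ j' := by
    rintro i j i' j' rfl rfl
    exact T.ne_and_ne_of_follows_arrow hε hz hyz hzx
  grind

theorem pairwise_isExterior_or (hε : ε ^ 2 = 1) {S : Set (Arrow Unit)}
    (hS : IsCyclicTriple (Follows (T.start 0)) S) (hsub : S ⊆ k.gaussDiagram.arrows)
    (hnot : ¬ {T.arrow T.top T.mid, T.arrow T.mid T.bot} ⊆ S) :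
    S.Pairwise fun x y => T.IsExterior x ∨ T.IsExterior y := by
  obtain ⟨x, y, z, rfl, hxy, hyz, hzx⟩ := hS
  have hrot : ∀ x y z : Arrow Unit, ({x, y, z} : Set (Arrow Unit)) = {y, z, x} := by grind
  have h₁ := T.isExterior_or_isExterior_of_follows hε hsub hnot hxy hyz hzx
  rw [hrot] at hsub hnot
  have h₂ := T.isExterior_or_isExterior_of_follows hε hsub hnot hyz hzx hxy
  rw [hrot] at hsub hnot
  have h₃ := T.isExterior_or_isExterior_of_follows hε hsub hnot hzx hxy hyz
  intro u hu v hv huv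
  grind

theorem crossParam_lt_of_lt (hε : ε ^ 2 = 1) (hij : i < j) (i' j' : Fin 3) :
    T.crossParam i i' < T.crossParam j j' := by
  have hi := T.crossParam_mem hε i i'
  have hj := T.crossParam_mem hε j j'
  refine T.region_monotone.reflect_lt ?_
  rw [(T.region_eq_insideRegion_iff (T.inside_subset i hi)).2 hi,
    (T.region_eq_insideRegion_iff (T.inside_subset j hj)).2 hj]
  clear hi hj
  revert i j; decide

theorem follows_arrow_iff (hε : ε ^ 2 = 1) {a b c : Fin 3} (hab : a ≠ b) (hbc : b ≠ c)
    (hac : a ≠ c) :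
    (Follows (T.start 0) (T.arrow a b) (T.arrow b c) ↔
      c = b + 1 ∧ T.crossParam b c < T.crossParam b a) ∧
    (Follows (T.start 0) (T.arrow b c) (T.arrow a b) ↔
      a = b + 1 ∧ T.crossParam b a < T.crossParam b c) := by
  have h01 := T.crossParam_lt_of_lt hε (i := 0) (j := 1) (by decide)
  have h12 := T.crossParam_lt_of_lt hε (i := 1) (j := 2) (by decide)
  have h02 := T.crossParam_lt_of_lt hε (i := 0) (j := 2) (by decide)
  have h10 := fun i j => (h01 i j).not_gt
  have h21 := fun i j => (h12 i j).not_gt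
  have h20 := fun i j => (h02 i j).not_gt
  unfold Follows CyclicLt
  simp only [arrow, T.rep_crossPt hε]
  fin_cases a <;> fin_cases b <;> fin_cases c <;>
    first
    | exact absurd rfl hab
    | exact absurd rfl hbc
    | exact absurd rfl hac
    | simp [h01, h12, h02, h10, h21, h20]

/-- The number of an exterior strand, which satisfies `T.IsNumberOf c (T.exteriorIndex c)`; see
`isNumberOf_iff`. -/
def exteriorIndex : ExteriorStrand → Fin 3
  | .a => if T.top = T.mid + 1 then T.mid else T.top
  | .b => if T.bot = T.mid + 1 then T.mid else T.bot

theorem isNumberOf_iff {c : ExteriorStrand} : T.IsNumberOf c i ↔ i = T.exteriorIndex c := by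
  cases c
  · change ({T.height i, T.height (i + 1)} : Set (Fin 3)) = {2, 1} ↔ _
    rw [pair_eq_pair_iff]
    unfold exteriorIndex top mid bot
    generalize T.height = e
    revert e i
    decide
  · change ({T.height i, T.height (i + 1)} : Set (Fin 3)) = {1, 0} ↔ _
    rw [pair_eq_pair_iff]
    unfold exteriorIndex top mid bot
    generalize T.height = e
    revert e i
    decide

theorem exteriorIndex_injective : Function.Injective T.exteriorIndex := by
  have hab : T.exteriorIndex .a ≠ T.exteriorIndex .b := by
    unfold exteriorIndex top mid bot
    generalize T.height = e
    revert e
    decide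
  rintro (_ | _) (_ | _) h
  exacts [rfl, absurd h hab, absurd h.symm hab, rfl]

open Classical in
/-- The arrows from the exterior strand `c` to the exterior strand `d`. -/
def exteriorArrows (c d : ExteriorStrand) : Finset (Arrow Unit) :=
  {x ∈ k.gaussDiagram.arrows | T.regionOf x.1 = exteriorRegion (T.exteriorIndex c) ∧
    T.regionOf x.2 = exteriorRegion (T.exteriorIndex d)}

theorem mem_exteriorArrows {c d : ExteriorStrand} {x : Arrow Unit} :
    x ∈ T.exteriorArrows c d ↔ x ∈ k.gaussDiagram.arrows ∧
      T.regionOf x.1 = exteriorRegion (T.exteriorIndex c) ∧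
        T.regionOf x.2 = exteriorRegion (T.exteriorIndex d) :=
  Finset.mem_filter

theorem not_isCyclicTriple_arrow_top_bot (hε : ε ^ 2 = 1) :
    ¬ IsCyclicTriple (Follows (T.start 0))
      {T.arrow T.top T.mid, T.arrow T.mid T.bot, T.arrow T.top T.bot} := by
  rw [isCyclicTriple_triple_iff (not_follows_self _)]
  rintro (⟨h₁, h₂, h₃⟩ | ⟨h₁, h₂, h₃⟩) <;>
    replace h₁ := T.cyclicLe_regionOf h₁ <;>
    replace h₂ := T.cyclicLe_regionOf h₂ <;>
    replace h₃ := T.cyclicLe_regionOf h₃ <;>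
    simp only [arrow, T.regionOf_crossPt hε, top, mid, bot] at h₁ h₂ h₃ <;>
    generalize T.height = e at h₁ h₂ h₃ <;>
    revert e <;> decide

theorem follows_arrow_iff_of_isExterior (hε : ε ^ 2 = 1) {x : Arrow Unit} {u v : Fin 3}
    (hu : T.regionOf x.1 = exteriorRegion u) (hv : T.regionOf x.2 = exteriorRegion v) :
    (Follows (T.start 0) (T.arrow i j) x ↔
      CyclicLt (insideRegion i) (exteriorRegion u) (insideRegion j) (exteriorRegion v)) ∧
    (Follows (T.start 0) x (T.arrow i j) ↔
      CyclicLt (exteriorRegion u) (insideRegion i) (exteriorRegion v) (insideRegion j)) := by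
  have hne := insideRegion_ne_exteriorRegion
  constructor <;> rw [T.follows_iff_cyclicLt_regionOf] <;>
    simp only [arrow, T.regionOf_crossPt hε, hu, hv, ne_eq, hne, (hne _ _).symm, not_false_eq_true]

theorem isCyclicTriple_iff_of_isExterior (hε : ε ^ 2 = 1) {x : Arrow Unit} {u v : Fin 3}
    (hu : T.regionOf x.1 = exteriorRegion u) (hv : T.regionOf x.2 = exteriorRegion v) :
    IsCyclicTriple (Follows (T.start 0)) {T.arrow T.top T.mid, T.arrow T.mid T.bot, x} ↔
      (u = T.exteriorIndex .b ∧ v = T.exteriorIndex .a) ∧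
        T.crossParam T.mid (T.mid + 1) < T.crossParam T.mid (T.mid - 1) := by
  have hregions : T.bot = T.mid + 1 ∧ T.top = T.mid - 1 ∧ T.top ≠ T.mid + 1 ∧
        (CyclicLt (insideRegion T.mid) (exteriorRegion u) (insideRegion T.bot) (exteriorRegion v) ∧
          CyclicLt (exteriorRegion u) (insideRegion T.top) (exteriorRegion v)
            (insideRegion T.mid) ↔ u = T.mid ∧ v = T.top) ∨
      T.bot = T.mid - 1 ∧ T.top = T.mid + 1 ∧ T.bot ≠ T.mid + 1 ∧
        (CyclicLt (insideRegion T.top) (exteriorRegion u) (insideRegion T.mid) (exteriorRegion v) ∧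
          CyclicLt (exteriorRegion u) (insideRegion T.mid) (exteriorRegion v)
            (insideRegion T.bot) ↔ u = T.bot ∧ v = T.mid) := by
    unfold top mid bot
    generalize T.height = e
    clear hu hv
    revert e u v
    decide
  obtain ⟨hfollows, hfollows'⟩ := T.follows_arrow_iff hε T.top_ne_mid T.mid_ne_bot T.top_ne_bot
  simp only [isCyclicTriple_triple_iff (not_follows_self _), hfollows, hfollows',
    (T.follows_arrow_iff_of_isExterior hε hu hv).1, (T.follows_arrow_iff_of_isExterior hε hu hv).2,
    exteriorIndex]
  rcases hregions with ⟨hbot, htop, hne, hiff⟩ | ⟨hbot, htop, hne, hiff⟩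
  · rw [if_pos hbot, if_neg hne, hiff, ← hbot, ← htop]
    simp only [T.top_ne_bot, false_and, or_false, true_and, and_comm]
  · rw [if_pos htop, if_neg hne, hiff, ← hbot, ← htop]
    simp only [T.top_ne_bot.symm, false_and, false_or, true_and, and_comm]

theorem isCyclicTriple_iff_mem_exteriorArrows (hε : ε ^ 2 = 1) {x : Arrow Unit}
    (hx : x ∈ k.gaussDiagram.arrows) :
    IsCyclicTriple (Follows (T.start 0)) {T.arrow T.top T.mid, T.arrow T.mid T.bot, x} ↔
      x ∈ T.exteriorArrows .b .a ∧ ¬ 0 < ε * T.edgeSign T.mid := by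
  have hinside : ∀ i j, T.arrow i j ∉ T.exteriorArrows .b .a := fun i j h =>
    T.not_isExterior_arrow hε i j
      ⟨⟨_, (T.mem_exteriorArrows.1 h).2.1⟩, ⟨_, (T.mem_exteriorArrows.1 h).2.2⟩⟩
  rcases T.mem_arrows_cases hε hx with rfl | rfl | rfl | ⟨⟨u, hu⟩, ⟨v, hv⟩⟩
  · rw [isCyclicTriple_triple_iff (not_follows_self _)]
    simp [hinside, not_follows_self]
  · rw [isCyclicTriple_triple_iff (not_follows_self _)]
    simp [hinside, not_follows_self]
  · simp [hinside, T.not_isCyclicTriple_arrow_top_bot hε]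
  · rw [T.isCyclicTriple_iff_of_isExterior hε hu hv, T.crossParam_lt_crossParam_iff_not hε,
      mem_exteriorArrows, hu, hv, exteriorRegion_injective.eq_iff, exteriorRegion_injective.eq_iff,
      and_iff_right hx]

end ThreeStrands

/-! ### Signs at the vanishing triangle -/

theorem modelOrder_mul_modelSign {a b c : Fin 3} (hab : a ≠ b) (hbc : b ≠ c) (hac : a ≠ c) :
    modelOrder b * (modelSign a b * modelSign b c) = 1 := by
  revert a b c; decide

namespace ThreeStrands

variable {k : KnotDiagram} {C : Set Plane} {ε : ℝ} (T : ThreeStrands k C ε)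

theorem sign_arrow (hε : ε ^ 2 = 1) {i j : Fin 3} (hij : i ≠ j) :
    k.gaussDiagram.sign (T.arrow i j) =
      T.direction i * T.direction j * modelSign (T.model i) (T.model j) := by
  simp only [← T.sign_planeDet_crossParam hε hij, LinkDiagram.gaussDiagram, arrow, crossPt,
    KnotDiagram.velocity_eq_deriv]

theorem top_mul_mid_mul_bot (f : Fin 3 → ℤ) : f T.top * f T.mid * f T.bot = ∏ i, f i := by
  rw [← Equiv.prod_comp T.height.symm f, Fin.prod_univ_three, top, mid, bot]
  ring

theorem prod_edgeSign : ∏ i, T.edgeSign i = T.cyclicParity * ∏ i, T.direction i := by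
  have horder : ∏ i, modelOrder (T.model i) = 1 := by
    rw [Equiv.prod_comp T.model modelOrder]
    decide
  unfold edgeSign
  rw [Finset.prod_mul_distrib, Finset.prod_mul_distrib, horder, Finset.prod_const]
  rcases T.cyclicParity_eq with h | h <;> simp [h]

theorem edgeSign_mid_mul_sign (hε : ε ^ 2 = 1) :
    T.edgeSign T.mid * (k.gaussDiagram.sign (T.arrow T.top T.mid) *
      k.gaussDiagram.sign (T.arrow T.mid T.bot)) = ∏ i, T.edgeSign i := by
  have hmodel := modelOrder_mul_modelSign (T.model.injective.ne T.top_ne_mid)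
    (T.model.injective.ne T.mid_ne_bot) (T.model.injective.ne T.top_ne_bot)
  have hmid : T.direction T.mid ^ 2 = 1 := sq_eq_one_iff.2 (T.direction_eq T.mid)
  rw [T.sign_arrow hε T.top_ne_mid, T.sign_arrow hε T.mid_ne_bot, T.prod_edgeSign,
    ← T.top_mul_mid_mul_bot, edgeSign]
  linear_combination T.cyclicParity * T.direction T.top * T.direction T.mid * T.direction T.bot *
    (T.direction T.mid ^ 2 * hmodel + hmid)

theorem q_eq_prod (hε : ε ^ 2 = 1) : (T.q : ℝ) = ∏ i, -(ε * T.edgeSign i) := by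
  classical
  have hedge : ∀ i, (if T.EdgeCoincides i then (-1 : ℝ) else 1) = -(ε * T.edgeSign i) := by
    intro i
    rw [T.edgeCoincides_iff hε, T.crossParam_lt_crossParam_iff hε]
    rcases sq_eq_one_iff.1 hε with rfl | rfl <;> rcases T.edgeSign_eq i with h | h <;> norm_num [h]
  rw [← Finset.prod_congr rfl fun i _ => hedge i, Finset.prod_ite, Finset.prod_const,
    Finset.prod_const_one, mul_one, q]
  push_cast
  rfl

end ThreeStrands

/-! ### Comparison of the two Gauss diagrams -/

namespace Omega3Move

variable {k l : KnotDiagram} {C : Set Plane} (m : Omega3Move k l C)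

theorem φ_strictMono : StrictMono m.φ := strictMono_of_deriv_pos m.φ_deriv_pos

theorem φ_nextStart (i : Fin 3) : m.φ (m.before.nextStart i) = m.after.nextStart i := by
  rw [m.before.nextStart_eq, m.after.nextStart_eq]
  split_ifs
  · rw [m.φ_add_one, m.φ_start]
  · rw [m.φ_start]

theorem path_start (i : Fin 3) : l.path (m.after.start i) = k.path (m.before.start i) := by
  have hnext : ∀ j, l.path (m.after.nextStart j) = k.path (m.before.nextStart j) := fun j => by
    rw [← m.φ_nextStart j,
      m.path_exterior j _ (right_mem_Icc.2 (m.before.finish_lt_nextStart j).le)]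
  fin_cases i
  · have h := hnext 2
    simp only [ThreeStrands.nextStart_eq, if_true, KnotDiagram.path_add_one] at h
    exact h
  · exact hnext 0
  · exact hnext 1

theorem direction_eq (i : Fin 3) : m.after.direction i = m.before.direction i := by
  have hboundary : m.before.chartPath (m.before.start i) ∉ Metric.ball (0 : Plane) 1 := by
    rw [plane_mem_ball, m.before.chartPath_sq_add_sq_of_end (one_pow 2) (Or.inl rfl)]
    exact lt_irrefl _
  have hchart : m.after.chartPath (m.after.start i) = m.before.chartPath (m.before.start i) := by
    rw [ThreeStrands.chartPath, m.path_start, ThreeStrands.chartPath]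
    exact (m.chart_eq _ (m.before.chart.mem_frontier (m.before.path_mem (m.before.start_mem i))
      hboundary)).symm
  have hzero := congrArg (fun p : Plane => p 0) hchart
  simp only [m.after.chartPath_start_zero neg_one_sq, m.before.chartPath_start_zero (one_pow 2),
    m.model_eq, neg_inj] at hzero
  exact_mod_cast mul_right_cancel₀ (modelEnd_pos (m.before.model i)).ne' hzero

theorem edgeSign_eq (i : Fin 3) : m.after.edgeSign i = m.before.edgeSign i := by
  rw [ThreeStrands.edgeSign, ThreeStrands.cyclicParity, m.direction_eq, m.model_eq]
  rfl

theorem top_eq : m.after.top = m.before.top := by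
  rw [ThreeStrands.top, m.height_eq, ThreeStrands.top]

theorem mid_eq : m.after.mid = m.before.mid := by
  rw [ThreeStrands.mid, m.height_eq, ThreeStrands.mid]

theorem bot_eq : m.after.bot = m.before.bot := by
  rw [ThreeStrands.bot, m.height_eq, ThreeStrands.bot]

theorem exteriorIndex_eq (c : ExteriorStrand) :
    m.after.exteriorIndex c = m.before.exteriorIndex c := by
  cases c <;> simp only [ThreeStrands.exteriorIndex, m.top_eq, m.mid_eq, m.bot_eq]

variable {i j : Fin 3} {s t : ℝ}

theorem path_φ (ht : t ∈ Ioo (m.before.finish i) (m.before.nextStart i)) :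
    l.path (m.φ t) = k.path t := m.path_exterior i t (Ioo_subset_Icc_self ht)

theorem φ_mem (ht : t ∈ Ioo (m.before.finish i) (m.before.nextStart i)) :
    m.φ t ∈ Ioo (m.after.finish i) (m.after.nextStart i) := by
  rw [← m.φ_finish, ← m.φ_nextStart]
  exact ⟨m.φ_strictMono ht.1, m.φ_strictMono ht.2⟩

theorem exists_φ_eq (ht : t ∈ Ioo (m.after.finish i) (m.after.nextStart i)) :
    ∃ s ∈ Ioo (m.before.finish i) (m.before.nextStart i), m.φ s = t := by
  have h := intermediate_value_Ioo (m.before.finish_lt_nextStart i).le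
    m.φ_smooth.continuous.continuousOn
  rw [m.φ_finish, m.φ_nextStart] at h
  exact h ht

theorem deriv_path_eq (ht : t ∈ Ioo (m.before.finish i) (m.before.nextStart i)) :
    deriv k.path t = deriv m.φ t • deriv l.path (m.φ t) := by
  have hφ : HasDerivAt m.φ (deriv m.φ t) t :=
    (m.φ_smooth.differentiable (by simp) t).hasDerivAt
  refine (((l.hasDerivAt_path (m.φ t)).scomp t hφ).congr_of_eventuallyEq ?_).deriv
  filter_upwards [isOpen_Ioo.mem_nhds ht] with u hu
  exact (m.path_φ hu).symm

theorem sign_planeDet_eq (hs : s ∈ Ioo (m.before.finish i) (m.before.nextStart i))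
    (ht : t ∈ Ioo (m.before.finish j) (m.before.nextStart j)) :
    SignType.sign (planeDet (deriv l.path (m.φ s)) (deriv l.path (m.φ t))) =
      SignType.sign (planeDet (deriv k.path s) (deriv k.path t)) := by
  rw [m.deriv_path_eq hs, m.deriv_path_eq ht, planeDet_smul_smul, sign_mul,
    sign_pos (mul_pos (m.φ_deriv_pos s) (m.φ_deriv_pos t)), one_mul]

/-- The map of the circle that is induced by the reparametrization `m.φ`. -/
def ptMap (p : Pt Unit) : Pt Unit := pt () (m.φ (rep (m.before.start 0) p))

theorem rep_ptMap (p : Pt Unit) :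
    rep (m.after.start 0) (m.ptMap p) = m.φ (rep (m.before.start 0) p) := by
  have h := rep_mem (m.before.start 0) p
  refine rep_pt () ⟨?_, ?_⟩ <;> rw [← m.φ_start]
  · exact m.φ_strictMono.monotone h.1
  · rw [← m.φ_add_one]
    exact m.φ_strictMono h.2

theorem ptMap_pt (ht : t ∈ Ioo (m.before.finish i) (m.before.nextStart i)) :
    m.ptMap (pt () t) = pt () (m.φ t) := by
  rw [ptMap, rep_pt () (m.before.exterior_subset i ht)]

theorem ptMap_injective : Function.Injective m.ptMap := fun p q h => by
  have hrep := congrArg (rep (m.after.start 0)) h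
  rw [rep_ptMap, rep_ptMap] at hrep
  exact rep_injective _ (m.φ_strictMono.injective hrep)

theorem regionOf_ptMap {p : Pt Unit} (h : m.before.regionOf p = exteriorRegion i) :
    m.after.regionOf (m.ptMap p) = exteriorRegion i := by
  obtain ⟨t, ht, rfl⟩ := m.before.exists_of_regionOf_eq_exteriorRegion h
  rw [m.ptMap_pt ht]
  exact m.after.regionOf_pt_of_mem_exterior (m.φ_mem ht)

theorem exists_ptMap_eq {p : Pt Unit} (h : m.after.regionOf p = exteriorRegion i) :
    ∃ q, m.before.regionOf q = exteriorRegion i ∧ m.ptMap q = p := by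
  obtain ⟨t, ht, rfl⟩ := m.after.exists_of_regionOf_eq_exteriorRegion h
  obtain ⟨s, hs, rfl⟩ := m.exists_φ_eq ht
  exact ⟨pt () s, m.before.regionOf_pt_of_mem_exterior hs, m.ptMap_pt hs⟩

theorem ptMap_mem_arrows_iff {x : Arrow Unit} (hx : m.before.IsExterior x) :
    (m.ptMap x.1, m.ptMap x.2) ∈ l.gaussDiagram.arrows ↔ x ∈ k.gaussDiagram.arrows := by
  obtain ⟨p, q⟩ := x
  obtain ⟨⟨i, hi⟩, ⟨j, hj⟩⟩ := hx
  have hne : m.ptMap p ≠ m.ptMap q ↔ p ≠ q := m.ptMap_injective.ne_iff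
  obtain ⟨s, hs, rfl⟩ := m.before.exists_of_regionOf_eq_exteriorRegion hi
  obtain ⟨t, ht, rfl⟩ := m.before.exists_of_regionOf_eq_exteriorRegion hj
  rw [LinkDiagram.mem_arrows, LinkDiagram.mem_arrows]
  simp only [m.ptMap_pt hs, m.ptMap_pt ht] at hne ⊢
  rw [KnotDiagram.crosses_iff, KnotDiagram.crosses_iff, hne, m.path_φ hs, m.path_φ ht]
  exact and_congr_right fun _ => m.over_exterior i s (Ioo_subset_Icc_self hs)

open Classical in
/-- The bijection between the arrows of the two Gauss diagrams. -/
def arrowMap (x : Arrow Unit) : Arrow Unit :=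
  if m.before.IsExterior x then (m.ptMap x.1, m.ptMap x.2) else
    m.after.arrow (Function.invFun insideRegion (m.before.regionOf x.1))
      (Function.invFun insideRegion (m.before.regionOf x.2))

theorem arrowMap_of_isExterior {x : Arrow Unit} (hx : m.before.IsExterior x) :
    m.arrowMap x = (m.ptMap x.1, m.ptMap x.2) := if_pos hx

theorem arrowMap_arrow (i j : Fin 3) : m.arrowMap (m.before.arrow i j) = m.after.arrow i j := by
  have hinv := Function.leftInverse_invFun insideRegion_injective
  rw [arrowMap, if_neg (m.before.not_isExterior_arrow (one_pow 2) i j)]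
  simp only [ThreeStrands.arrow, m.before.regionOf_crossPt (one_pow 2), hinv i, hinv j]

variable {x y : Arrow Unit}

theorem regionOf_arrowMap (hx : x ∈ k.gaussDiagram.arrows) :
    m.after.regionOf (m.arrowMap x).1 = m.before.regionOf x.1 ∧
      m.after.regionOf (m.arrowMap x).2 = m.before.regionOf x.2 := by
  rcases m.before.exists_eq_arrow_or_isExterior (one_pow 2) hx with ⟨i, j, -, rfl⟩ | hx'
  · rw [m.arrowMap_arrow]
    simp only [ThreeStrands.arrow, m.before.regionOf_crossPt (one_pow 2),
      m.after.regionOf_crossPt neg_one_sq, and_self]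
  · obtain ⟨⟨i, hi⟩, ⟨j, hj⟩⟩ := id hx'
    rw [m.arrowMap_of_isExterior hx', hi, hj]
    exact ⟨m.regionOf_ptMap hi, m.regionOf_ptMap hj⟩

theorem isExterior_arrowMap (hx : x ∈ k.gaussDiagram.arrows) :
    m.after.IsExterior (m.arrowMap x) ↔ m.before.IsExterior x := by
  unfold ThreeStrands.IsExterior
  rw [(m.regionOf_arrowMap hx).1, (m.regionOf_arrowMap hx).2]

theorem injOn_arrowMap : InjOn m.arrowMap k.gaussDiagram.arrows := by
  intro x hx y hy h
  have hext : m.before.IsExterior x ↔ m.before.IsExterior y := by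
    rw [← m.isExterior_arrowMap hx, h, m.isExterior_arrowMap hy]
  rcases m.before.exists_eq_arrow_or_isExterior (one_pow 2) hx with ⟨i, j, -, rfl⟩ | hx' <;>
    rcases m.before.exists_eq_arrow_or_isExterior (one_pow 2) hy with ⟨i', j', -, rfl⟩ | hy'
  · rw [m.arrowMap_arrow, m.arrowMap_arrow, m.after.arrow_eq_arrow_iff neg_one_sq] at h
    rw [h.1, h.2]
  · exact absurd (hext.2 hy') (m.before.not_isExterior_arrow (one_pow 2) _ _)
  · exact absurd (hext.1 hx') (m.before.not_isExterior_arrow (one_pow 2) _ _)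
  · rw [m.arrowMap_of_isExterior hx', m.arrowMap_of_isExterior hy', Prod.mk.injEq] at h
    exact Prod.ext (m.ptMap_injective h.1) (m.ptMap_injective h.2)

theorem arrowMap_mem_arrows (hx : x ∈ k.gaussDiagram.arrows) :
    m.arrowMap x ∈ l.gaussDiagram.arrows := by
  rcases m.before.exists_eq_arrow_or_isExterior (one_pow 2) hx with ⟨i, j, hij, rfl⟩ | hx'
  · rwa [m.arrowMap_arrow, m.after.arrow_mem_arrows_iff neg_one_sq hij, m.height_eq,
      ← m.before.arrow_mem_arrows_iff (one_pow 2) hij]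
  · rwa [m.arrowMap_of_isExterior hx', m.ptMap_mem_arrows_iff hx']

theorem exists_arrowMap_eq (hy : y ∈ l.gaussDiagram.arrows) :
    ∃ x ∈ k.gaussDiagram.arrows, m.arrowMap x = y := by
  rcases m.after.exists_eq_arrow_or_isExterior neg_one_sq hy with
    ⟨i, j, hij, rfl⟩ | ⟨⟨i, hi⟩, ⟨j, hj⟩⟩
  · refine ⟨m.before.arrow i j, ?_, m.arrowMap_arrow i j⟩
    rwa [m.before.arrow_mem_arrows_iff (one_pow 2) hij, ← m.height_eq,
      ← m.after.arrow_mem_arrows_iff neg_one_sq hij]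
  · obtain ⟨p, hp, hp'⟩ := m.exists_ptMap_eq hi
    obtain ⟨q, hq, hq'⟩ := m.exists_ptMap_eq hj
    have hx : m.before.IsExterior (p, q) := ⟨⟨i, hp⟩, ⟨j, hq⟩⟩
    have hpq : (m.ptMap p, m.ptMap q) = y := Prod.ext hp' hq'
    exact ⟨(p, q), (m.ptMap_mem_arrows_iff hx).1 (hpq ▸ hy),
      (m.arrowMap_of_isExterior hx).trans hpq⟩

theorem arrows_eq_image [DecidableEq (Arrow Unit)] :
    l.gaussDiagram.arrows = k.gaussDiagram.arrows.image m.arrowMap := by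
  ext y
  rw [Finset.mem_image]
  refine ⟨m.exists_arrowMap_eq, ?_⟩
  rintro ⟨x, hx, rfl⟩
  exact m.arrowMap_mem_arrows hx

theorem sign_arrowMap (hx : x ∈ k.gaussDiagram.arrows) :
    l.gaussDiagram.sign (m.arrowMap x) = k.gaussDiagram.sign x := by
  rcases m.before.exists_eq_arrow_or_isExterior (one_pow 2) hx with ⟨i, j, hij, rfl⟩ | hx'
  · rw [m.arrowMap_arrow, m.after.sign_arrow neg_one_sq hij, m.before.sign_arrow (one_pow 2) hij,
      m.direction_eq, m.direction_eq, m.model_eq]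
  · rw [m.arrowMap_of_isExterior hx']
    obtain ⟨p, q⟩ := x
    obtain ⟨⟨i, hi⟩, ⟨j, hj⟩⟩ := hx'
    obtain ⟨s, hs, rfl⟩ := m.before.exists_of_regionOf_eq_exteriorRegion hi
    obtain ⟨t, ht, rfl⟩ := m.before.exists_of_regionOf_eq_exteriorRegion hj
    simp only [LinkDiagram.gaussDiagram, m.ptMap_pt hs, m.ptMap_pt ht,
      KnotDiagram.velocity_eq_deriv, m.sign_planeDet_eq hs ht]

theorem follows_arrowMap (hx : x ∈ k.gaussDiagram.arrows) (hy : y ∈ k.gaussDiagram.arrows)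
    (hxy : m.before.IsExterior x ∨ m.before.IsExterior y) :
    Follows (m.after.start 0) (m.arrowMap x) (m.arrowMap y) ↔
      Follows (m.before.start 0) x y := by
  have hregions : m.before.regionOf x.1 ≠ m.before.regionOf y.1 →
      m.before.regionOf y.1 ≠ m.before.regionOf x.2 →
      m.before.regionOf x.2 ≠ m.before.regionOf y.2 →
      m.before.regionOf y.2 ≠ m.before.regionOf x.1 →
      (Follows (m.after.start 0) (m.arrowMap x) (m.arrowMap y) ↔
        Follows (m.before.start 0) x y) := by
    intro h₁ h₂ h₃ h₄
    rw [m.before.follows_iff_cyclicLt_regionOf h₁ h₂ h₃ h₄, m.after.follows_iff_cyclicLt_regionOf]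
      <;> simp only [(m.regionOf_arrowMap hx).1, (m.regionOf_arrowMap hx).2,
        (m.regionOf_arrowMap hy).1, (m.regionOf_arrowMap hy).2] <;> assumption
  have hne := insideRegion_ne_exteriorRegion
  rcases m.before.exists_eq_arrow_or_isExterior (one_pow 2) hx with ⟨i, j, -, rfl⟩ | hx' <;>
    rcases m.before.exists_eq_arrow_or_isExterior (one_pow 2) hy with ⟨i', j', -, rfl⟩ | hy'
  · exact (hxy.elim (m.before.not_isExterior_arrow (one_pow 2) _ _)
      (m.before.not_isExterior_arrow (one_pow 2) _ _)).elim
  · obtain ⟨⟨u, hu⟩, ⟨v, hv⟩⟩ := hy'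
    apply hregions <;> simp only [hu, hv, ThreeStrands.arrow,
      m.before.regionOf_crossPt (one_pow 2)] <;> first | exact hne _ _ | exact (hne _ _).symm
  · obtain ⟨⟨u, hu⟩, ⟨v, hv⟩⟩ := hx'
    apply hregions <;> simp only [hu, hv, ThreeStrands.arrow,
      m.before.regionOf_crossPt (one_pow 2)] <;> first | exact hne _ _ | exact (hne _ _).symm
  · rw [m.arrowMap_of_isExterior hx', m.arrowMap_of_isExterior hy']
    unfold Follows CyclicLt
    simp only [m.rep_ptMap, m.φ_strictMono.lt_iff_lt]

-- The ends of two arrows at the changing disk may be met in a different order after the move, but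
-- these arrows do not belong to a common cyclic triple unless one of them leads from the top to the
-- middle and the other from the middle to the bottom strand.
theorem isCyclicTriple_arrowMap_iff {S : Set (Arrow Unit)} (hS : S ⊆ k.gaussDiagram.arrows)
    (hnot : ¬ {m.before.arrow m.before.top m.before.mid,
      m.before.arrow m.before.mid m.before.bot} ⊆ S) :
    IsCyclicTriple (fun x y => Follows (m.after.start 0) (m.arrowMap x) (m.arrowMap y)) S ↔
      IsCyclicTriple (Follows (m.before.start 0)) S := by
  constructor <;> intro h
  · have hnot' : ¬ {m.after.arrow m.after.top m.after.mid,
        m.after.arrow m.after.mid m.after.bot} ⊆ m.arrowMap '' S := by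
      rw [insert_subset_iff, singleton_subset_iff] at hnot ⊢
      rwa [m.top_eq, m.mid_eq, m.bot_eq, ← m.arrowMap_arrow, ← m.arrowMap_arrow,
        m.injOn_arrowMap.mem_image_iff hS (m.before.arrow_top_mid_mem_arrows (one_pow 2)),
        m.injOn_arrowMap.mem_image_iff hS (m.before.arrow_mid_bot_mem_arrows (one_pow 2))]
    have hpairwise := m.after.pairwise_isExterior_or neg_one_sq
      ((isCyclicTriple_image (m.injOn_arrowMap.mono hS)).2 h)
      (image_subset_iff.2 fun x hx => m.arrowMap_mem_arrows (hS hx)) hnot'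
    refine h.mono fun x hx y hy hxy => (m.follows_arrowMap (hS hx) (hS hy) ?_).1 hxy
    have hne : m.arrowMap x ≠ m.arrowMap y := fun e => not_follows_self _ _ (e ▸ hxy)
    rw [← m.isExterior_arrowMap (hS hx), ← m.isExterior_arrowMap (hS hy)]
    exact hpairwise (mem_image_of_mem _ hx) (mem_image_of_mem _ hy) hne
  · have hpairwise := m.before.pairwise_isExterior_or (one_pow 2) h hS hnot
    refine h.mono fun x hx y hy hxy => (m.follows_arrowMap (hS hx) (hS hy) ?_).2 hxy
    exact hpairwise hx hy (by rintro rfl; exact not_follows_self _ _ hxy)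

theorem arrowMap_mem_exteriorArrows_iff {c d : ExteriorStrand} (hx : x ∈ k.gaussDiagram.arrows) :
    m.arrowMap x ∈ m.after.exteriorArrows c d ↔ x ∈ m.before.exteriorArrows c d := by
  rw [ThreeStrands.mem_exteriorArrows, ThreeStrands.mem_exteriorArrows, (m.regionOf_arrowMap hx).1,
    (m.regionOf_arrowMap hx).2, m.exteriorIndex_eq, m.exteriorIndex_eq,
    and_iff_right hx, and_iff_right (m.arrowMap_mem_arrows hx)]

theorem isCyclicTriple_arrowMap_iff_mem_exteriorArrows (hx : x ∈ k.gaussDiagram.arrows) :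
    IsCyclicTriple (fun x y => Follows (m.after.start 0) (m.arrowMap x) (m.arrowMap y))
      {m.before.arrow m.before.top m.before.mid, m.before.arrow m.before.mid m.before.bot, x} ↔
    x ∈ m.before.exteriorArrows .b .a ∧ ¬ (0 : ℝ) < -1 * m.before.edgeSign m.before.mid := by
  have hsub : {m.before.arrow m.before.top m.before.mid, m.before.arrow m.before.mid m.before.bot,
      x} ⊆ (k.gaussDiagram.arrows : Set (Arrow Unit)) := by
    simp only [insert_subset_iff, singleton_subset_iff, Finset.mem_coe, hx, and_true]
    exact ⟨m.before.arrow_top_mid_mem_arrows (one_pow 2),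
      m.before.arrow_mid_bot_mem_arrows (one_pow 2)⟩
  have h := m.after.isCyclicTriple_iff_mem_exteriorArrows neg_one_sq (m.arrowMap_mem_arrows hx)
  rw [m.arrowMap_mem_exteriorArrows_iff hx, m.top_eq, m.mid_eq, m.bot_eq, m.edgeSign_eq] at h
  rw [← h, ← isCyclicTriple_image (m.injOn_arrowMap.mono hsub), image_insert_eq, image_insert_eq,
    image_singleton, m.arrowMap_arrow, m.arrowMap_arrow]

open Classical in
theorem sum_filter_isCyclicTriple {R : Arrow Unit → Arrow Unit → Prop} {r : ℝ}
    (hR : ∀ x ∈ k.gaussDiagram.arrows,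
      (IsCyclicTriple R {m.before.arrow m.before.top m.before.mid,
        m.before.arrow m.before.mid m.before.bot, x} ↔
          x ∈ m.before.exteriorArrows .b .a ∧ ¬ 0 < r)) :
    ∑ x ∈ k.gaussDiagram.arrows with IsCyclicTriple R {m.before.arrow m.before.top m.before.mid,
      m.before.arrow m.before.mid m.before.bot, x}, k.gaussDiagram.sign x =
        if 0 < r then 0 else ∑ x ∈ m.before.exteriorArrows .b .a, k.gaussDiagram.sign x := by
  rw [Finset.filter_congr hR]
  split_ifs with hr
  · simp [hr]
  · refine Finset.sum_congr (Finset.ext fun x => ?_) fun _ _ => rfl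
    simp only [Finset.mem_filter, hr, not_false_eq_true, and_true, and_iff_right_iff_imp]
    exact fun hx => (m.before.mem_exteriorArrows.1 hx).1

theorem weirdness_sub_eq_edgeSign_mul : l.weirdness - k.weirdness =
    m.before.edgeSign m.before.mid *
      (k.gaussDiagram.sign (m.before.arrow m.before.top m.before.mid) *
        k.gaussDiagram.sign (m.before.arrow m.before.mid m.before.bot)) *
      ∑ x ∈ m.before.exteriorArrows .b .a, k.gaussDiagram.sign x := by
  classical
  have hsub := cyclicTripleSum_sub (R := Follows (m.before.start 0))
    (R' := fun x y => Follows (m.after.start 0) (m.arrowMap x) (m.arrowMap y)) k.gaussDiagram.sign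
    (m.before.arrow_top_mid_mem_arrows (one_pow 2)) (m.before.arrow_mid_bot_mem_arrows (one_pow 2))
    (m.before.arrow_top_mid_ne_arrow_mid_bot (one_pow 2)) (not_follows_self _)
    (fun _ => not_follows_self _ _) fun S hS h => m.isCyclicTriple_arrowMap_iff
      (by exact_mod_cast hS) (by simpa [insert_subset_iff] using h)
  rw [m.sum_filter_isCyclicTriple fun x hx => m.isCyclicTriple_arrowMap_iff_mem_exteriorArrows hx,
    m.sum_filter_isCyclicTriple fun x hx =>
      m.before.isCyclicTriple_iff_mem_exteriorArrows (one_pow 2) hx] at hsub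
  unfold KnotDiagram.weirdness
  rw [l.gaussDiagram.w3_eq (m.after.start 0), k.gaussDiagram.w3_eq (m.before.start 0),
    m.arrows_eq_image, cyclicTripleSum_image m.injOn_arrowMap,
    cyclicTripleSum_congr (s' := k.gaussDiagram.sign) fun x hx => m.sign_arrowMap hx, hsub]
  rcases m.before.edgeSign_eq m.before.mid with h | h <;> norm_num [h]

theorem weirdness_sub : l.weirdness - k.weirdness =
    m.after.q * ∑ x ∈ m.before.exteriorArrows .b .a, k.gaussDiagram.sign x := by
  have hq : m.after.q = ∏ i, m.before.edgeSign i := by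
    have h := m.after.q_eq_prod neg_one_sq
    simp only [neg_mul, one_mul, neg_neg, m.edgeSign_eq] at h
    exact_mod_cast h
  rw [m.weirdness_sub_eq_edgeSign_mul, m.before.edgeSign_mid_mul_sign (one_pow 2), hq]

end Omega3Move

/-! ### The linking number of a local link -/

namespace ClosedCurves

variable {ι : Type}

theorem ext_rep {p q : Pt ι} {a : ℝ} (hindex : p.1 = q.1) (hrep : rep a p = rep a q) : p = q := by
  rw [← pt_rep a p, ← pt_rep a q, hindex, hrep]

theorem eval_eq_curve_rep (K : ClosedCurves ι) (p : Pt ι) :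
    K.eval p = K.curve p.1 (rep 0 p) := by
  conv_lhs => rw [← pt_rep 0 p, eval_pt]

theorem velocity_eq_deriv_rep (K : ClosedCurves ι) (p : Pt ι) :
    K.velocity p = deriv (K.curve p.1) (rep 0 p) := by
  conv_lhs => rw [← pt_rep 0 p, velocity_pt]

/-- The points with parameter in `(0, 1/2)`: in the local link, the interiors of the exterior
strands. -/
def firstHalf : Set (Pt ι) := {p | rep 0 p ∈ Ioo (0 : ℝ) (1 / 2)}

/-- The points with parameter in `(1/2, 1)`: in the local link, the interiors of the closing
strands. -/
def secondHalf : Set (Pt ι) := {p | rep 0 p ∈ Ioo (1 / 2 : ℝ) 1}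

theorem disjoint_firstHalf_secondHalf : Disjoint (firstHalf : Set (Pt ι)) secondHalf :=
  disjoint_left.2 fun _ hp hp' => hp.2.not_gt hp'.1

end ClosedCurves

namespace ThreeStrands

variable {k : KnotDiagram} {C : Set Plane} {ε : ℝ} (T : ThreeStrands k C ε)
variable {i j : Fin 3} {s t u : ℝ} {p q : Pt ExteriorStrand}

theorem path_nextStart (i : Fin 3) : k.path (T.nextStart i) = k.path (T.start (i + 1)) := by
  rw [T.nextStart_eq]
  split_ifs with h
  · subst h
    exact k.path_add_one _
  · rfl

theorem path_start_ne_path_finish (hε : ε ^ 2 = 1) (i j : Fin 3) :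
    k.path (T.start i) ≠ k.path (T.finish j) := by
  intro h
  by_cases hij : i = j
  · subst hij
    exact (T.start_lt_finish i).ne (T.injOn_path i (T.start_mem i) (T.finish_mem i) h)
  · exact (T.crossParam_ne_end hε i j).1
      ((T.path_eq_iff hε hij (T.start_mem i) (T.finish_mem j)).1 h).1.symm

theorem path_start_injective (hε : ε ^ 2 = 1) : Function.Injective fun i => k.path (T.start i) := by
  intro i j h
  by_contra hij
  exact (T.crossParam_ne_end hε i j).1
    ((T.path_eq_iff hε hij (T.start_mem i) (T.start_mem j)).1 h).1.symm

theorem path_finish_injective (hε : ε ^ 2 = 1) :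
    Function.Injective fun i => k.path (T.finish i) := by
  intro i j h
  by_contra hij
  exact (T.crossParam_ne_end hε i j).2
    ((T.path_eq_iff hε hij (T.finish_mem i) (T.finish_mem j)).1 h).1.symm

theorem path_end_notMem_interior (hε : ε ^ 2 = 1) (ht : t = T.start i ∨ t = T.finish i) :
    k.path t ∉ interior C := by
  intro h
  have hball := (T.chart.mem_interior_iff (interior_subset h)).1 h
  exact (plane_mem_ball.1 hball).ne (T.chartPath_sq_add_sq_of_end hε ht)

theorem mem_exterior_cases (ht : t ∈ Icc (T.finish i) (T.nextStart i)) :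
    t ∈ Ioo (T.finish i) (T.nextStart i) ∨ t = T.finish i ∨ t = T.nextStart i := by
  rcases eq_endpoints_or_mem_Ioo_of_mem_Icc ht with h | h | h
  exacts [Or.inr (Or.inl h), Or.inr (Or.inr h), Or.inl h]

theorem path_notMem_interior (hε : ε ^ 2 = 1) (ht : t ∈ Icc (T.finish i) (T.nextStart i)) :
    k.path t ∉ interior C := by
  rcases T.mem_exterior_cases ht with h | rfl | rfl
  · exact fun h' => T.path_notMem h (interior_subset h')
  · exact T.path_end_notMem_interior hε (Or.inr rfl)
  · rw [T.path_nextStart]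
    exact T.path_end_notMem_interior hε (Or.inl rfl)

theorem mem_Ioo_or_eq_of_path_eq (hε : ε ^ 2 = 1) (hs : s ∈ Icc (T.finish i) (T.nextStart i))
    (ht : t ∈ Icc (T.finish j) (T.nextStart j)) (h : k.path s = k.path t) :
    (s ∈ Ioo (T.finish i) (T.nextStart i) ∧ t ∈ Ioo (T.finish j) (T.nextStart j)) ∨
      i = j ∧ s = t := by
  have hfinish : ∀ i, k.path (T.finish i) ∈ C := fun i => T.path_mem (T.finish_mem i)
  have hnextStart : ∀ i, k.path (T.nextStart i) ∈ C := fun i => by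
    rw [T.path_nextStart]
    exact T.path_mem (T.start_mem _)
  rcases T.mem_exterior_cases hs with hs | rfl | rfl <;>
    rcases T.mem_exterior_cases ht with ht | rfl | rfl
  · exact Or.inl ⟨hs, ht⟩
  · exact absurd (h ▸ hfinish _) (T.path_notMem hs)
  · exact absurd (h ▸ hnextStart _) (T.path_notMem hs)
  · exact absurd (h ▸ hfinish _) (T.path_notMem ht)
  · obtain rfl := T.path_finish_injective hε h
    exact Or.inr ⟨rfl, rfl⟩
  · rw [T.path_nextStart] at h
    exact absurd h.symm (T.path_start_ne_path_finish hε _ _)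
  · exact absurd (h ▸ hnextStart _) (T.path_notMem ht)
  · rw [T.path_nextStart] at h
    exact absurd h (T.path_start_ne_path_finish hε _ _)
  · rw [T.path_nextStart, T.path_nextStart] at h
    obtain rfl := add_right_cancel (T.path_start_injective hε h)
    exact Or.inr ⟨rfl, rfl⟩

theorem exteriorParam_eq (i : Fin 3) (u : ℝ) :
    T.exteriorParam i u = 2 * (T.nextStart i - T.finish i) * u + T.finish i := by
  rw [exteriorParam, AffineMap.lineMap_apply_ring']
  ring

theorem exteriorParam_strictMono (i : Fin 3) : StrictMono (T.exteriorParam i) := by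
  intro u v huv
  rw [exteriorParam_eq, exteriorParam_eq]
  have := T.finish_lt_nextStart i
  nlinarith

theorem exteriorParam_zero (i : Fin 3) : T.exteriorParam i 0 = T.finish i := by
  rw [exteriorParam_eq]
  ring

theorem exteriorParam_half (i : Fin 3) : T.exteriorParam i (1 / 2) = T.nextStart i := by
  rw [exteriorParam_eq]
  ring

theorem exteriorParam_mem_Icc (hu : u ∈ Icc (0 : ℝ) (1 / 2)) :
    T.exteriorParam i u ∈ Icc (T.finish i) (T.nextStart i) := by
  rw [← T.exteriorParam_zero, ← T.exteriorParam_half]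
  exact (T.exteriorParam_strictMono i).monotone.mapsTo_Icc hu

theorem exteriorParam_mem_Ioo_iff :
    T.exteriorParam i u ∈ Ioo (T.finish i) (T.nextStart i) ↔ u ∈ Ioo (0 : ℝ) (1 / 2) := by
  rw [← T.exteriorParam_zero, ← T.exteriorParam_half, mem_Ioo,
    (T.exteriorParam_strictMono i).lt_iff_lt, (T.exteriorParam_strictMono i).lt_iff_lt, mem_Ioo]

theorem exists_exteriorParam_eq (ht : t ∈ Ioo (T.finish i) (T.nextStart i)) :
    ∃ u ∈ Ioo (0 : ℝ) (1 / 2), T.exteriorParam i u = t := by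
  have hne : T.nextStart i - T.finish i ≠ 0 := (sub_pos.2 (T.finish_lt_nextStart i)).ne'
  have hparam :
      T.exteriorParam i ((t - T.finish i) / (2 * (T.nextStart i - T.finish i))) = t := by
    rw [exteriorParam_eq]
    field_simp
    ring
  exact ⟨_, T.exteriorParam_mem_Ioo_iff.1 (hparam.symm ▸ ht), hparam⟩

theorem hasDerivAt_exteriorParam (i : Fin 3) (u : ℝ) :
    HasDerivAt (T.exteriorParam i) (2 * (T.nextStart i - T.finish i)) u := by
  rw [funext (T.exteriorParam_eq i)]
  simpa using ((hasDerivAt_id u).const_mul (2 * (T.nextStart i - T.finish i))).add_const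
    (T.finish i)

theorem hasDerivAt_path_exteriorParam (i : Fin 3) (u : ℝ) :
    HasDerivAt (fun u => k.path (T.exteriorParam i u))
      ((2 * (T.nextStart i - T.finish i)) • deriv k.path (T.exteriorParam i u)) u :=
  (k.hasDerivAt_path _).scomp u (T.hasDerivAt_exteriorParam i u)

/-- The point of the parametrizing circle of `k` that corresponds to a point in the first half of a
component of the local link. -/
def exteriorPt (p : Pt ExteriorStrand) : Pt Unit :=
  pt () (T.exteriorParam (T.exteriorIndex p.1) (rep 0 p))

theorem regionOf_exteriorPt (hp : p ∈ firstHalf) :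
    T.regionOf (T.exteriorPt p) = exteriorRegion (T.exteriorIndex p.1) :=
  T.regionOf_pt_of_mem_exterior (T.exteriorParam_mem_Ioo_iff.2 hp)

theorem injOn_exteriorPt : InjOn T.exteriorPt firstHalf := by
  intro p hp q hq h
  have hregion := congrArg T.regionOf h
  rw [T.regionOf_exteriorPt hp, T.regionOf_exteriorPt hq] at hregion
  have hindex := exteriorRegion_injective hregion
  rw [exteriorPt, exteriorPt, ← hindex,
    pt_eq_iff_of_mem (T.exterior_subset _ (T.exteriorParam_mem_Ioo_iff.2 hp))
      (T.exterior_subset _ (T.exteriorParam_mem_Ioo_iff.2 hq))] at h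
  exact ext_rep (T.exteriorIndex_injective hindex) ((T.exteriorParam_strictMono _).injective h.2)

theorem exists_exteriorPt_eq {x : Pt Unit} {c : ExteriorStrand}
    (hx : T.regionOf x = exteriorRegion (T.exteriorIndex c)) :
    ∃ p ∈ firstHalf, p.1 = c ∧ T.exteriorPt p = x := by
  obtain ⟨t, ht, rfl⟩ := T.exists_of_regionOf_eq_exteriorRegion hx
  obtain ⟨u, hu, rfl⟩ := T.exists_exteriorParam_eq ht
  have hrep : rep 0 (pt c u) = u := rep_pt c ⟨hu.1.le, by linarith [hu.2]⟩
  exact ⟨pt c u, show rep 0 (pt c u) ∈ _ from hrep.symm ▸ hu, rfl, by rw [exteriorPt, hrep]; rfl⟩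

/-- The first halves of the closed curves `K` are the exterior strands `a` and `b`, and their
second halves lie in the changing disk. -/
structure ClosesExterior (T : ThreeStrands k C ε) (K : ClosedCurves ExteriorStrand) : Prop where
  curve_eq : ∀ c, ∀ u ∈ Icc (0 : ℝ) (1 / 2),
    K.curve c u = k.path (T.exteriorParam (T.exteriorIndex c) u)
  curve_mem_interior : ∀ c, ∀ u ∈ Ioo (1 / 2 : ℝ) 1, K.curve c u ∈ interior C

namespace ClosesExterior

variable {T} {K : ClosedCurves ExteriorStrand} (hK : T.ClosesExterior K)
include hK

theorem eval_eq (hp : rep 0 p ≤ 1 / 2) : K.eval p = k.eval (T.exteriorPt p) := by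
  rw [eval_eq_curve_rep, hK.curve_eq _ _ ⟨(rep_mem 0 p).1, hp⟩, exteriorPt, k.eval_eq_path]

theorem curve_eventuallyEq (hp : p ∈ firstHalf) :
    K.curve p.1 =ᶠ[nhds (rep 0 p)] fun u => k.path (T.exteriorParam (T.exteriorIndex p.1) u) := by
  filter_upwards [isOpen_Ioo.mem_nhds hp] with u hu
  exact hK.curve_eq _ u (Ioo_subset_Icc_self hu)

theorem velocity_eq_smul (hp : p ∈ firstHalf) :
    K.velocity p = (2 * (T.nextStart (T.exteriorIndex p.1) - T.finish (T.exteriorIndex p.1))) •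
      k.velocity (T.exteriorPt p) := by
  rw [velocity_eq_deriv_rep, exteriorPt, k.velocity_eq_deriv]
  have hderiv := T.hasDerivAt_path_exteriorParam (T.exteriorIndex p.1) (rep 0 p)
  exact (hderiv.congr_of_eventuallyEq (hK.curve_eventuallyEq hp)).deriv

theorem crosses_iff (hp : p ∈ firstHalf) (hq : q ∈ firstHalf) :
    K.Crosses p q ↔ k.Crosses (T.exteriorPt p) (T.exteriorPt q) := by
  rw [Crosses, Crosses, hK.eval_eq hp.2.le, hK.eval_eq hq.2.le, T.injOn_exteriorPt.ne_iff hp hq]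

theorem planeDet_velocity (hp : p ∈ firstHalf) (hq : q ∈ firstHalf) :
    ∃ r > 0, planeDet (K.velocity p) (K.velocity q) =
      r * planeDet (k.velocity (T.exteriorPt p)) (k.velocity (T.exteriorPt q)) := by
  have hp' := sub_pos.2 (T.finish_lt_nextStart (T.exteriorIndex p.1))
  have hq' := sub_pos.2 (T.finish_lt_nextStart (T.exteriorIndex q.1))
  rw [hK.velocity_eq_smul hp, hK.velocity_eq_smul hq, planeDet_smul_smul]
  exact ⟨_, by positivity, rfl⟩

theorem eval_mem_interior (hp : 1 / 2 < rep 0 p) : K.eval p ∈ interior C := by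
  rw [eval_eq_curve_rep]
  exact hK.curve_mem_interior _ _ ⟨hp, zero_add (1 : ℝ) ▸ (rep_mem 0 p).2⟩

theorem eval_notMem_interior (hε : ε ^ 2 = 1) (hp : rep 0 p ≤ 1 / 2) :
    K.eval p ∉ interior C := by
  rw [hK.eval_eq hp, exteriorPt, k.eval_eq_path]
  exact T.path_notMem_interior hε (T.exteriorParam_mem_Icc ⟨(rep_mem 0 p).1, hp⟩)

theorem mem_halves_of_crosses (hε : ε ^ 2 = 1) (h : K.Crosses p q) :
    (p ∈ firstHalf ∧ q ∈ firstHalf) ∨ p ∈ secondHalf ∧ q ∈ secondHalf := by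
  have hlt : ∀ p : Pt ExteriorStrand, rep 0 p < 1 := fun p =>
    zero_add (1 : ℝ) ▸ (rep_mem 0 p).2
  rcases le_or_gt (rep 0 p) (1 / 2) with hp | hp <;> rcases le_or_gt (rep 0 q) (1 / 2) with hq | hq
  · left
    have heval := h.2
    rw [hK.eval_eq hp, hK.eval_eq hq, exteriorPt, exteriorPt, k.eval_eq_path, k.eval_eq_path]
      at heval
    rcases T.mem_Ioo_or_eq_of_path_eq hε (T.exteriorParam_mem_Icc ⟨(rep_mem 0 p).1, hp⟩)
      (T.exteriorParam_mem_Icc ⟨(rep_mem 0 q).1, hq⟩) heval with ⟨hs, ht⟩ | ⟨hindex, hparam⟩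
    · exact ⟨T.exteriorParam_mem_Ioo_iff.1 hs, T.exteriorParam_mem_Ioo_iff.1 ht⟩
    · rw [hindex] at hparam
      exact absurd (ext_rep (T.exteriorIndex_injective hindex)
        ((T.exteriorParam_strictMono _).injective hparam)) h.1
  · exact absurd (h.2 ▸ hK.eval_mem_interior hq) (hK.eval_notMem_interior hε hp)
  · exact absurd (h.2 ▸ hK.eval_mem_interior hp) (hK.eval_notMem_interior hε hq)
  · exact Or.inr ⟨⟨hp, hlt p⟩, hq, hlt q⟩

end ClosesExterior

namespace IsLocalLink

variable {T} {L : LinkDiagram ExteriorStrand} (hL : T.IsLocalLink L)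
include hL

theorem closesExterior : T.ClosesExterior L.toClosedCurves where
  curve_eq c u hu := hL.exterior c _ (T.isNumberOf_iff.2 rfl) u hu
  curve_mem_interior := hL.closing

theorem mem_arrows_iff (hp : p ∈ firstHalf) (hq : q ∈ firstHalf) :
    (p, q) ∈ L.gaussDiagram.arrows ↔
      (T.exteriorPt p, T.exteriorPt q) ∈ k.gaussDiagram.arrows := by
  rw [LinkDiagram.mem_arrows, LinkDiagram.mem_arrows, ← hL.closesExterior.crosses_iff hp hq]
  refine and_congr_right fun h => ?_
  have hover := hL.over_exterior p.1 _ (T.isNumberOf_iff.2 rfl) _ (Ioo_subset_Icc_self hp)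
  rw [pt_rep] at hover
  exact hover ⟨q, h⟩

theorem sign_eq (hp : p ∈ firstHalf) (hq : q ∈ firstHalf) :
    L.gaussDiagram.sign (p, q) = k.gaussDiagram.sign (T.exteriorPt p, T.exteriorPt q) := by
  obtain ⟨r, hr, hdet⟩ := hL.closesExterior.planeDet_velocity hp hq
  simp only [LinkDiagram.gaussDiagram, hdet]
  rw [sign_mul, sign_pos hr, one_mul]

theorem mem_firstHalf_of_mem_arrows (hε : ε ^ 2 = 1) (hpq : (p, q) ∈ L.gaussDiagram.arrows)
    (hp : p.1 = .b) (hq : q.1 = .a) : p ∈ firstHalf ∧ q ∈ firstHalf := by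
  obtain ⟨hcross, hover⟩ := (L.mem_arrows _).1 hpq
  refine (hL.closesExterior.mem_halves_of_crosses hε hcross).resolve_right fun ⟨hp', hq'⟩ => ?_
  have hcurve := hcross.2
  rw [eval_eq_curve_rep, eval_eq_curve_rep, hp, hq] at hcurve
  refine hL.closing_not_over _ hp' _ hq' hcurve ?_
  rwa [← hp, pt_rep]

theorem linkingNumber_eq (hε : ε ^ 2 = 1) :
    L.linkingNumber .b .a = ∑ x ∈ T.exteriorArrows .b .a, k.gaussDiagram.sign x := by
  classical
  have hhalf : ∀ {x}, x ∈ L.gaussDiagram.arrows.filter (fun x => x.1.1 = .b ∧ x.2.1 = .a) →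
      x.1 ∈ firstHalf ∧ x.2 ∈ firstHalf := fun hx => by
    obtain ⟨hx, hb, ha⟩ := Finset.mem_filter.1 hx
    exact hL.mem_firstHalf_of_mem_arrows hε hx hb ha
  unfold LinkDiagram.linkingNumber
  refine Finset.sum_bij (fun x _ => (T.exteriorPt x.1, T.exteriorPt x.2)) (fun x hx => ?_)
    (fun x hx y hy h => ?_) (fun y hy => ?_) fun x hx => ?_
  · obtain ⟨harrow, hb, ha⟩ := Finset.mem_filter.1 hx
    obtain ⟨htail, hhead⟩ := hhalf hx
    rw [mem_exteriorArrows, T.regionOf_exteriorPt htail, T.regionOf_exteriorPt hhead, hb, ha]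
    exact ⟨(hL.mem_arrows_iff htail hhead).1 harrow, rfl, rfl⟩
  · rw [Prod.mk.injEq] at h
    exact Prod.ext (T.injOn_exteriorPt (hhalf hx).1 (hhalf hy).1 h.1)
      (T.injOn_exteriorPt (hhalf hx).2 (hhalf hy).2 h.2)
  · obtain ⟨harrow, htail, hhead⟩ := T.mem_exteriorArrows.1 hy
    obtain ⟨p, hp, hb, hpy⟩ := T.exists_exteriorPt_eq htail
    obtain ⟨q, hq, ha, hqy⟩ := T.exists_exteriorPt_eq hhead
    refine ⟨(p, q), Finset.mem_filter.2 ⟨(hL.mem_arrows_iff hp hq).2 ?_, hb, ha⟩, ?_⟩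
    · rwa [hpy, hqy]
    · rw [hpy, hqy]
  · exact hL.sign_eq (hhalf hx).1 (hhalf hx).2

end IsLocalLink

end ThreeStrands

/-! ### Chords of the unit circle -/

theorem plane_mem_sphere {p : Plane} :
    p ∈ Metric.sphere (0 : Plane) 1 ↔ p 0 ^ 2 + p 1 ^ 2 = 1 := by
  rw [mem_sphere_zero_iff_norm, ← plane_norm_sq,
    pow_eq_one_iff_of_nonneg (norm_nonneg p) two_ne_zero]

theorem exists_eq_smul_of_planeDet_eq_zero {v w : Plane} (hv : v ≠ 0) (h : planeDet v w = 0) :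
    ∃ c : ℝ, w = c • v := by
  have hnorm : v 0 ^ 2 + v 1 ^ 2 ≠ 0 := by
    rw [← plane_norm_sq]
    exact pow_ne_zero 2 (norm_ne_zero_iff.2 hv)
  unfold planeDet at h
  refine ⟨(v 0 * w 0 + v 1 * w 1) / (v 0 ^ 2 + v 1 ^ 2), plane_ext ?_ ?_⟩ <;>
    simp only [PiLp.smul_apply, smul_eq_mul] <;> field_simp
  · linear_combination (-(v 1)) * h
  · linear_combination v 0 * h

theorem eq_zero_of_smul_eq_smul {v w : Plane} (h : planeDet v w ≠ 0) {a b : ℝ}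
    (hab : a • v = b • w) : a = 0 ∧ b = 0 := by
  have hfst := congrArg (fun x : Plane => x 0) hab
  have hsnd := congrArg (fun x : Plane => x 1) hab
  simp only [PiLp.smul_apply, smul_eq_mul] at hfst hsnd
  constructor <;> apply (mul_eq_zero.1 _).resolve_right h <;> unfold planeDet
  · linear_combination w 1 * hfst - w 0 * hsnd
  · linear_combination v 1 * hfst - v 0 * hsnd

theorem planeDet_sub_ne_zero_of_lineMap_eq {p q p' q' : Plane}
    (hp : p ∈ Metric.sphere (0 : Plane) 1) (hq : q ∈ Metric.sphere (0 : Plane) 1)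
    (hp' : p' ∈ Metric.sphere (0 : Plane) 1) (hpq : p ≠ q) (hpp' : p ≠ p') (hqp' : q ≠ p')
    {s t : ℝ} (h : (AffineMap.lineMap p q s : Plane) = AffineMap.lineMap p' q' t) :
    planeDet (q - p) (q' - p') ≠ 0 := by
  intro hdet
  obtain ⟨c, hc⟩ := exists_eq_smul_of_planeDet_eq_zero (sub_ne_zero.2 hpq.symm) hdet
  have hline : p' = AffineMap.lineMap p q (s - t * c) := by
    rw [AffineMap.lineMap_apply_module', AffineMap.lineMap_apply_module', hc] at h
    rw [AffineMap.lineMap_apply_module', sub_smul, mul_smul, sub_add_eq_add_sub, h,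
      add_sub_cancel_left]
  have hcospherical : EuclideanGeometry.Cospherical (Metric.sphere (0 : Plane) 1) :=
    ⟨0, 1, fun _ h => h⟩
  have hindep := hcospherical.affineIndependent_of_mem_of_ne hp' hp hq hpp'.symm hqp'.symm hpq
  rw [affineIndependent_iff_not_collinear_set] at hindep
  exact hindep (collinear_insert_of_mem_affineSpan_pair
    (hline ▸ AffineMap.lineMap_mem_affineSpan_pair _ _ _))

theorem lineMap_eq_lineMap_unique {p q p' q' : Plane} (hdet : planeDet (q - p) (q' - p') ≠ 0)
    {s t s' t' : ℝ} (h : (AffineMap.lineMap p q s : Plane) = AffineMap.lineMap p' q' t)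
    (h' : (AffineMap.lineMap p q s' : Plane) = AffineMap.lineMap p' q' t') : s = s' ∧ t = t' := by
  have hsmul : (s - s') • (q - p) = (t - t') • (q' - p') := by
    simp only [AffineMap.lineMap_apply_module'] at h h'
    rw [sub_smul, sub_smul, eq_sub_of_add_eq h, eq_sub_of_add_eq h']
    abel
  obtain ⟨hs, ht⟩ := eq_zero_of_smul_eq_smul hdet hsmul
  exact ⟨sub_eq_zero.1 hs, sub_eq_zero.1 ht⟩

/-! ### Closed curves that consist of two pieces -/

/-- The plane curve `g` is a smooth immersion near the parameter `t`. -/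
def ImmersedAt (g : ℝ → Plane) (t : ℝ) : Prop := ContDiffAt ℝ ∞ g t ∧ deriv g t ≠ 0

theorem ImmersedAt.congr {f g : ℝ → Plane} {t : ℝ} (h : ImmersedAt g t) (hfg : f =ᶠ[nhds t] g) :
    ImmersedAt f t :=
  ⟨h.1.congr_of_eventuallyEq hfg, hfg.deriv_eq ▸ h.2⟩

theorem ImmersedAt.comp_sub_const {g : ℝ → Plane} {t a : ℝ} (h : ImmersedAt g (t - a)) :
    ImmersedAt (fun u => g (u - a)) t := by
  rw [ImmersedAt, deriv_comp_sub_const]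
  exact ⟨h.1.comp t (contDiffAt_id.sub contDiffAt_const), h.2⟩

/-- The closed curve that consists of the restrictions of `g₁` and `g₂` to `[0, 1/2]` and
`[1/2, 1]`. -/
def glue (g₁ g₂ : ℝ → Plane) (t : ℝ) : Plane :=
  if Int.fract t ≤ 1 / 2 then g₁ (Int.fract t) else g₂ (Int.fract t)

section Glue

variable {g₁ g₂ : ℝ → Plane} {t : ℝ} {n : ℤ}

theorem glue_periodic (g₁ g₂ : ℝ → Plane) : Function.Periodic (glue g₁ g₂) 1 := by
  intro t
  rw [glue, Int.fract_add_one, glue]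

theorem glue_of_mem_left (ht : t ∈ Icc (n : ℝ) (n + 1 / 2)) : glue g₁ g₂ t = g₁ (t - n) := by
  have hfract : Int.fract t = t - n := by
    rw [Int.fract_eq_iff]
    exact ⟨by linarith [ht.1], by linarith [ht.2], n, by ring⟩
  rw [glue, hfract, if_pos (by linarith [ht.2])]

theorem glue_of_mem_right (hhalf : g₁ (1 / 2) = g₂ (1 / 2)) (hone : g₂ 1 = g₁ 0)
    (ht : t ∈ Icc ((n : ℝ) + 1 / 2) (n + 1)) : glue g₁ g₂ t = g₂ (t - n) := by
  rcases eq_endpoints_or_mem_Ioo_of_mem_Icc ht with rfl | rfl | ht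
  · rw [glue_of_mem_left (n := n) ⟨by linarith, le_rfl⟩, add_sub_cancel_left, hhalf]
  · rw [glue_of_mem_left (n := n + 1) ⟨by push_cast; rfl, by push_cast; linarith⟩]
    push_cast
    rw [sub_self, add_sub_cancel_left, hone]
  · have hfract : Int.fract t = t - n := by
      rw [Int.fract_eq_iff]
      exact ⟨by linarith [ht.1], by linarith [ht.2], n, by ring⟩
    rw [glue, hfract, if_neg (by linarith [ht.1])]

theorem exists_Icc_subset_half_integers (t : ℝ) : ∃ δ > 0,
    (∃ m : ℤ, Icc (t - δ) t ⊆ Icc ((m : ℝ) / 2) (m / 2 + 1 / 2)) ∧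
      ∃ m : ℤ, Icc t (t + δ) ⊆ Icc ((m : ℝ) / 2) (m / 2 + 1 / 2) := by
  have hceil := Int.ceil_lt_add_one (2 * t)
  have hfloor := Int.lt_floor_add_one (2 * t)
  refine ⟨min (t - (⌈2 * t⌉ - 1) / 2) ((⌊2 * t⌋ + 1) / 2 - t),
    lt_min (by linarith) (by linarith),
    ⟨⌈2 * t⌉ - 1, Icc_subset_Icc ?_ ?_⟩, ⟨⌊2 * t⌋, Icc_subset_Icc ?_ ?_⟩⟩
  · push_cast
    linarith [min_le_left (t - (⌈2 * t⌉ - 1) / 2) ((⌊2 * t⌋ + 1) / 2 - t)]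
  · push_cast
    linarith [Int.le_ceil (2 * t)]
  · linarith [Int.floor_le (2 * t)]
  · linarith [min_le_right (t - (⌈2 * t⌉ - 1) / 2) ((⌊2 * t⌋ + 1) / 2 - t)]

namespace ClosedCurves

variable {ι : Type} {K : ClosedCurves ι} {i : ι}

theorem regularAt_of_regularAt_rep {a : ℝ} (h : K.RegularAt i (rep a (pt i t))) :
    K.RegularAt i t := by
  obtain ⟨m, hm⟩ := exists_rep_pt_eq_add a i t
  have hcurve : K.curve i = fun u => K.curve i (u - (-m : ℤ)) := by
    funext u
    exact ((K.periodic i).sub_int_mul_eq (-m) (x := u) |>.symm).trans (by rw [mul_one])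
  have hshift := ImmersedAt.comp_sub_const (g := K.curve i) (t := t) (a := (-m : ℤ)) (by
    rw [Int.cast_neg, sub_neg_eq_add, ← hm]
    exact h)
  rwa [← hcurve] at hshift

theorem regularOn_of_eqOn {s t : ℝ} (hst : s < t) {g : ℝ → Plane}
    (h : EqOn (K.curve i) g (Icc s t)) (hg : ∀ u ∈ Icc s t, ImmersedAt g u) :
    K.RegularOn i s t := by
  refine ⟨ContDiffOn.congr (fun u hu => (hg u hu).1.contDiffWithinAt) h, fun u hu => ?_⟩
  rw [derivWithin_congr h (h hu),
    ((hg u hu).1.differentiableAt (by simp)).derivWithin (uniqueDiffOn_Icc hst u hu)]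
  exact (hg u hu).2

theorem piecewise_regular_of_curve_eq_glue (hK : K.curve i = glue g₁ g₂)
    (hhalf : g₁ (1 / 2) = g₂ (1 / 2)) (hone : g₂ 1 = g₁ 0)
    (hg₁ : ∀ u ∈ Icc (0 : ℝ) (1 / 2), ImmersedAt g₁ u)
    (hg₂ : ∀ u ∈ Icc (1 / 2 : ℝ) 1, ImmersedAt g₂ u) (t : ℝ) :
    ∃ δ > 0, K.RegularOn i (t - δ) t ∧ K.RegularOn i t (t + δ) := by
  have regularOn : ∀ a b : ℝ, a < b →
      (∃ m : ℤ, Icc a b ⊆ Icc ((m : ℝ) / 2) (m / 2 + 1 / 2)) → K.RegularOn i a b := by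
    rintro a b hab ⟨m, hm⟩
    obtain ⟨n, rfl | rfl⟩ := Int.even_or_odd' m <;> push_cast at hm
    · have hn : ∀ u ∈ Icc a b, u ∈ Icc (n : ℝ) (n + 1 / 2) := fun u hu =>
        ⟨by linarith [(hm hu).1], by linarith [(hm hu).2]⟩
      exact regularOn_of_eqOn hab (fun u hu => hK ▸ glue_of_mem_left (hn u hu)) fun u hu =>
        (hg₁ _ ⟨by linarith [(hn u hu).1], by linarith [(hn u hu).2]⟩).comp_sub_const
    · have hn : ∀ u ∈ Icc a b, u ∈ Icc ((n : ℝ) + 1 / 2) (n + 1) := fun u hu =>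
        ⟨by linarith [(hm hu).1], by linarith [(hm hu).2]⟩
      exact regularOn_of_eqOn hab (fun u hu => hK ▸ glue_of_mem_right hhalf hone (hn u hu))
        fun u hu => (hg₂ _ ⟨by linarith [(hn u hu).1], by linarith [(hn u hu).2]⟩).comp_sub_const
  obtain ⟨δ, hδ, hleft, hright⟩ := exists_Icc_subset_half_integers t
  exact ⟨δ, hδ, regularOn _ _ (by linarith) hleft, regularOn _ _ (by linarith) hright⟩

end ClosedCurves

end Glue

/-! ### Existence of the local link -/

namespace ThreeStrands

variable {k : KnotDiagram} {C : Set Plane} {ε : ℝ} (T : ThreeStrands k C ε)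
variable {u v : ℝ} {c d : ExteriorStrand} {p q r : Pt ExteriorStrand}

/-- The point of the unit circle, in the chart, where the chord that closes an exterior strand
starts. -/
def chordStart (c : ExteriorStrand) : Plane := T.chartPath (T.start (T.exteriorIndex c + 1))

/-- The point of the unit circle, in the chart, where the chord that closes an exterior strand
ends. -/
def chordEnd (c : ExteriorStrand) : Plane := T.chartPath (T.finish (T.exteriorIndex c))

/-- The chord that closes an exterior strand in the chart, parametrized by `[1/2, 1]`. -/
def chord (c : ExteriorStrand) (u : ℝ) : Plane :=
  AffineMap.lineMap (T.chordStart c) (T.chordEnd c) (2 * u - 1)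

/-- The strand inside the changing disk that closes an exterior strand, parametrized by
`[1/2, 1]`. -/
def closing (c : ExteriorStrand) (u : ℝ) : Plane := T.chart.toHomeo.symm (T.chord c u)

theorem chordStart_mem_sphere (hε : ε ^ 2 = 1) (c : ExteriorStrand) :
    T.chordStart c ∈ Metric.sphere (0 : Plane) 1 :=
  plane_mem_sphere.2 (T.chartPath_sq_add_sq_of_end hε (Or.inl rfl))

theorem chordEnd_mem_sphere (hε : ε ^ 2 = 1) (c : ExteriorStrand) :
    T.chordEnd c ∈ Metric.sphere (0 : Plane) 1 :=
  plane_mem_sphere.2 (T.chartPath_sq_add_sq_of_end hε (Or.inr rfl))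

theorem chordStart_ne_chordEnd (hε : ε ^ 2 = 1) (c d : ExteriorStrand) :
    T.chordStart c ≠ T.chordEnd d := by
  rw [chordStart, chordEnd, Ne, ← T.path_eq_iff_chartPath_eq (T.start_mem _) (T.finish_mem _)]
  exact T.path_start_ne_path_finish hε _ _

theorem chordStart_injective (hε : ε ^ 2 = 1) : Function.Injective T.chordStart := by
  intro c d h
  rw [chordStart, chordStart, ← T.path_eq_iff_chartPath_eq (T.start_mem _) (T.start_mem _)] at h
  exact T.exteriorIndex_injective (add_right_cancel (T.path_start_injective hε h))

theorem chord_mem_closedBall (hε : ε ^ 2 = 1) (c : ExteriorStrand) (hu : u ∈ Icc (1 / 2 : ℝ) 1) :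
    T.chord c u ∈ Metric.closedBall (0 : Plane) 1 :=
  (convex_closedBall _ _).lineMap_mem
    (Metric.sphere_subset_closedBall (T.chordStart_mem_sphere hε c))
    (Metric.sphere_subset_closedBall (T.chordEnd_mem_sphere hε c))
    ⟨by linarith [hu.1], by linarith [hu.2]⟩

theorem chord_mem_ball (hε : ε ^ 2 = 1) (c : ExteriorStrand) (hu : u ∈ Ioo (1 / 2 : ℝ) 1) :
    T.chord c u ∈ Metric.ball (0 : Plane) 1 := by
  refine openSegment_subset_ball_of_ne
    (Metric.sphere_subset_closedBall (T.chordStart_mem_sphere hε c))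
    (Metric.sphere_subset_closedBall (T.chordEnd_mem_sphere hε c))
    (T.chordStart_ne_chordEnd hε c c) ?_
  rw [openSegment_eq_image_lineMap]
  exact mem_image_of_mem _ ⟨by linarith [hu.1], by linarith [hu.2]⟩

theorem chord_mem_target (hε : ε ^ 2 = 1) (c : ExteriorStrand) (hu : u ∈ Icc (1 / 2 : ℝ) 1) :
    T.chord c u ∈ T.chart.toHomeo.target :=
  T.chart.closedBall_subset_target (T.chord_mem_closedBall hε c hu)

theorem closing_mem_interior (hε : ε ^ 2 = 1) (c : ExteriorStrand) (hu : u ∈ Ioo (1 / 2 : ℝ) 1) :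
    T.closing c u ∈ interior C := by
  have hu' := Ioo_subset_Icc_self hu
  rw [closing, T.chart.mem_interior_iff (T.chart.symm_mem (T.chord_mem_closedBall hε c hu')),
    T.chart.toHomeo.right_inv (T.chord_mem_target hε c hu')]
  exact T.chord_mem_ball hε c hu

theorem closing_eq_iff (hε : ε ^ 2 = 1) (hu : u ∈ Icc (1 / 2 : ℝ) 1) (hv : v ∈ Icc (1 / 2 : ℝ) 1) :
    T.closing c u = T.closing d v ↔ T.chord c u = T.chord d v :=
  T.chart.toHomeo.symm.injOn.eq_iff (T.chord_mem_target hε c hu) (T.chord_mem_target hε d hv)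

theorem chord_injective (hε : ε ^ 2 = 1) (c : ExteriorStrand) : Function.Injective (T.chord c) := by
  intro u v h
  have := AffineMap.lineMap_injective ℝ (T.chordStart_ne_chordEnd hε c c) h
  linarith

theorem planeDet_chord_ne_zero (hε : ε ^ 2 = 1) (hcd : c ≠ d) (h : T.chord c u = T.chord d v) :
    planeDet (T.chordEnd c - T.chordStart c) (T.chordEnd d - T.chordStart d) ≠ 0 :=
  planeDet_sub_ne_zero_of_lineMap_eq (T.chordStart_mem_sphere hε c) (T.chordEnd_mem_sphere hε c)
    (T.chordStart_mem_sphere hε d) (T.chordStart_ne_chordEnd hε c c)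
    ((T.chordStart_injective hε).ne hcd) (T.chordStart_ne_chordEnd hε d c).symm h

theorem closing_half (c : ExteriorStrand) :
    k.path (T.exteriorParam (T.exteriorIndex c) (1 / 2)) = T.closing c (1 / 2) := by
  have hchord : T.chord c (1 / 2) = T.chordStart c := by
    rw [chord, mul_one_div_cancel two_ne_zero, sub_self, AffineMap.lineMap_apply_zero]
  rw [T.exteriorParam_half, path_nextStart, closing, hchord]
  exact (T.chart.toHomeo.left_inv (T.chart.subset_source (T.path_mem (T.start_mem _)))).symm

theorem closing_one (c : ExteriorStrand) :
    T.closing c 1 = k.path (T.exteriorParam (T.exteriorIndex c) 0) := by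
  have hchord : T.chord c 1 = T.chordEnd c := by
    rw [chord, show (2 : ℝ) * 1 - 1 = 1 by norm_num, AffineMap.lineMap_apply_one]
  rw [T.exteriorParam_zero, closing, hchord]
  exact T.chart.toHomeo.left_inv (T.chart.subset_source (T.path_mem (T.finish_mem _)))

theorem hasDerivAt_chord (c : ExteriorStrand) (u : ℝ) :
    HasDerivAt (T.chord c) ((2 : ℝ) • (T.chordEnd c - T.chordStart c)) u := by
  have h : HasDerivAt (fun u : ℝ => 2 * u - 1) 2 u := by
    simpa using ((hasDerivAt_id u).const_mul 2).sub_const 1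
  exact (AffineMap.hasDerivAt_lineMap (a := T.chordStart c) (b := T.chordEnd c)).scomp u h

theorem contDiff_chord (c : ExteriorStrand) : ContDiff ℝ ∞ (T.chord c) := by
  have : T.chord c =
      fun u : ℝ => (2 * u - 1) • (T.chordEnd c - T.chordStart c) + T.chordStart c :=
    funext fun u => AffineMap.lineMap_apply_module' _ _ _
  rw [this]
  fun_prop

theorem hasDerivAt_closing (hε : ε ^ 2 = 1) (c : ExteriorStrand) (hu : u ∈ Icc (1 / 2 : ℝ) 1) :
    HasDerivAt (T.closing c) (fderiv ℝ T.chart.toHomeo.symm (T.chord c u)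
      ((2 : ℝ) • (T.chordEnd c - T.chordStart c))) u :=
  (T.chart.hasFDerivAt_symm (T.chord_mem_target hε c hu)).comp_hasDerivAt u (T.hasDerivAt_chord c u)

theorem fderiv_chart_deriv_closing (hε : ε ^ 2 = 1) (c : ExteriorStrand)
    (hu : u ∈ Icc (1 / 2 : ℝ) 1) :
    fderiv ℝ T.chart.toHomeo (T.closing c u) (deriv (T.closing c) u) =
      (2 : ℝ) • (T.chordEnd c - T.chordStart c) := by
  rw [(T.hasDerivAt_closing hε c hu).deriv, closing,
    T.chart.fderiv_fderiv_symm (T.chord_mem_target hε c hu)]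

theorem immersedAt_closing (hε : ε ^ 2 = 1) (c : ExteriorStrand) (hu : u ∈ Icc (1 / 2 : ℝ) 1) :
    ImmersedAt (T.closing c) u := by
  refine ⟨(T.chart.contDiffAt_symm (T.chord_mem_target hε c hu)).comp u
    (T.contDiff_chord c).contDiffAt, fun hderiv => ?_⟩
  have hzero := T.fderiv_chart_deriv_closing hε c hu
  rw [hderiv, map_zero] at hzero
  exact T.chordStart_ne_chordEnd hε c c
    (sub_eq_zero.1 ((smul_eq_zero.1 hzero.symm).resolve_left two_ne_zero)).symm

theorem planeDet_closing_ne_zero (hε : ε ^ 2 = 1) (hu : u ∈ Icc (1 / 2 : ℝ) 1)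
    (hv : v ∈ Icc (1 / 2 : ℝ) 1) (hcd : c ≠ d) (h : T.chord c u = T.chord d v) :
    planeDet (deriv (T.closing c) u) (deriv (T.closing d) v) ≠ 0 := by
  intro hdet
  have hv_fderiv := T.fderiv_chart_deriv_closing hε d hv
  rw [← (T.closing_eq_iff hε hu hv).2 h] at hv_fderiv
  have hmap := planeDet_map (fderiv ℝ T.chart.toHomeo (T.closing c u)) (deriv (T.closing c) u)
    (deriv (T.closing d) v)
  rw [T.fderiv_chart_deriv_closing hε c hu, hv_fderiv, planeDet_smul_smul, hdet, mul_zero] at hmap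
  exact mul_ne_zero (by norm_num) (T.planeDet_chord_ne_zero hε hcd h) hmap

theorem immersedAt_exterior (i : Fin 3) (u : ℝ) :
    ImmersedAt (fun u => k.path (T.exteriorParam i u)) u := by
  constructor
  · have hparam : ContDiff ℝ ∞ (T.exteriorParam i) := by
      rw [funext (T.exteriorParam_eq i)]
      fun_prop
    exact (k.regular _).1.comp u hparam.contDiffAt
  · rw [(T.hasDerivAt_path_exteriorParam i u).deriv]
    have := T.finish_lt_nextStart i
    exact smul_ne_zero (by linarith) (k.deriv_path_ne_zero _)

/-- The exterior strands `a` and `b`, closed by chords. -/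
def localCurves : ClosedCurves ExteriorStrand where
  curve c := glue (fun u => k.path (T.exteriorParam (T.exteriorIndex c) u)) (T.closing c)
  periodic _ := glue_periodic _ _

theorem localCurves_closing (c : ExteriorStrand) (hu : u ∈ Icc (1 / 2 : ℝ) 1) :
    T.localCurves.curve c u = T.closing c u := by
  have h := glue_of_mem_right (n := 0) (t := u) (g₂ := T.closing c)
    (g₁ := fun u => k.path (T.exteriorParam (T.exteriorIndex c) u)) (T.closing_half c)
    (T.closing_one c) (by simpa using hu)
  rwa [Int.cast_zero, sub_zero] at h

theorem closesExterior_localCurves (hε : ε ^ 2 = 1) : T.ClosesExterior T.localCurves where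
  curve_eq c u hu := by
    have h := glue_of_mem_left (n := 0) (t := u) (g₂ := T.closing c)
      (g₁ := fun u => k.path (T.exteriorParam (T.exteriorIndex c) u)) (by simpa using hu)
    rwa [Int.cast_zero, sub_zero] at h
  curve_mem_interior c u hu := by
    rw [T.localCurves_closing c (Ioo_subset_Icc_self hu)]
    exact T.closing_mem_interior hε c hu

theorem localCurves_eventuallyEq_closing (hp : p ∈ secondHalf) :
    T.localCurves.curve p.1 =ᶠ[nhds (rep 0 p)] T.closing p.1 := by
  filter_upwards [isOpen_Ioo.mem_nhds hp] with u hu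
  exact T.localCurves_closing _ (Ioo_subset_Icc_self hu)

theorem chord_eq_of_localCurves_crosses (hε : ε ^ 2 = 1) (hp : p ∈ secondHalf)
    (hq : q ∈ secondHalf) (h : T.localCurves.Crosses p q) :
    p.1 ≠ q.1 ∧ T.chord p.1 (rep 0 p) = T.chord q.1 (rep 0 q) := by
  have hp' := Ioo_subset_Icc_self hp
  have hq' := Ioo_subset_Icc_self hq
  obtain ⟨hne, heval⟩ := h
  rw [eval_eq_curve_rep, eval_eq_curve_rep, T.localCurves_closing _ hp',
    T.localCurves_closing _ hq', T.closing_eq_iff hε hp' hq'] at heval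
  refine ⟨fun hindex => hne (ext_rep (a := 0) hindex ?_), heval⟩
  rw [hindex] at heval
  exact T.chord_injective hε _ heval

theorem localCurves_regularAt (hε : ε ^ 2 = 1) {t : ℝ} (h : T.localCurves.Crosses (pt c t) q) :
    T.localCurves.RegularAt c t := by
  apply regularAt_of_regularAt_rep (a := 0)
  rcases (T.closesExterior_localCurves hε).mem_halves_of_crosses hε h with ⟨hp, -⟩ | ⟨hp, -⟩
  · exact (T.immersedAt_exterior _ _).congr
      ((T.closesExterior_localCurves hε).curve_eventuallyEq hp)
  · exact (T.immersedAt_closing hε _ (Ioo_subset_Icc_self hp)).congr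
      (T.localCurves_eventuallyEq_closing hp)

theorem localCurves_transversal (hε : ε ^ 2 = 1) (h : T.localCurves.Crosses p q) :
    planeDet (T.localCurves.velocity p) (T.localCurves.velocity q) ≠ 0 := by
  have hT := T.closesExterior_localCurves hε
  rcases hT.mem_halves_of_crosses hε h with ⟨hp, hq⟩ | ⟨hp, hq⟩
  · obtain ⟨r, hr, hdet⟩ := hT.planeDet_velocity hp hq
    rw [hdet]
    exact mul_ne_zero hr.ne' (k.transversal _ _ ((hT.crosses_iff hp hq).1 h))
  · obtain ⟨hindex, hchord⟩ := T.chord_eq_of_localCurves_crosses hε hp hq h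
    rw [velocity_eq_deriv_rep, velocity_eq_deriv_rep,
      (T.localCurves_eventuallyEq_closing hp).deriv_eq,
      (T.localCurves_eventuallyEq_closing hq).deriv_eq]
    exact T.planeDet_closing_ne_zero hε (Ioo_subset_Icc_self hp) (Ioo_subset_Icc_self hq)
      hindex hchord

theorem localCurves_no_triple (hε : ε ^ 2 = 1) (hpq : T.localCurves.Crosses p q)
    (hqr : T.localCurves.Crosses q r) : p = r := by
  have hT := T.closesExterior_localCurves hε
  have hdisjoint : q ∈ firstHalf → q ∉ secondHalf := fun h =>
    disjoint_left.1 disjoint_firstHalf_secondHalf h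
  rcases hT.mem_halves_of_crosses hε hpq with ⟨hp, hq⟩ | ⟨hp, hq⟩ <;>
    rcases hT.mem_halves_of_crosses hε hqr with ⟨hq', hr⟩ | ⟨hq', hr⟩
  · exact T.injOn_exteriorPt hp hr (k.no_triple _ _ _ ((hT.crosses_iff hp hq).1 hpq)
      ((hT.crosses_iff hq hr).1 hqr))
  · exact absurd hq' (hdisjoint hq)
  · exact absurd hq (hdisjoint hq')
  · obtain ⟨hne, hchord⟩ := T.chord_eq_of_localCurves_crosses hε hp hq hpq
    obtain ⟨hne', hchord'⟩ := T.chord_eq_of_localCurves_crosses hε hq hr hqr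
    have hindex : p.1 = r.1 := by
      cases hp : p.1 <;> cases hq : q.1 <;> cases hr : r.1 <;> simp_all only [ne_eq, not_true]
    have hmeet := hchord.trans hchord'
    rw [hindex] at hmeet
    exact ext_rep hindex (T.chord_injective hε _ hmeet)

theorem finite_crossings_firstHalf (hε : ε ^ 2 = 1) :
    {x : Arrow ExteriorStrand | T.localCurves.Crosses x.1 x.2 ∧
      x.1 ∈ firstHalf ∧ x.2 ∈ firstHalf}.Finite := by
  refine Set.Finite.of_injOn (f := fun x => (T.exteriorPt x.1, T.exteriorPt x.2))
    (fun x hx => ?_) (fun x hx y hy h => ?_) k.finite_crossings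
  · exact ((T.closesExterior_localCurves hε).crosses_iff hx.2.1 hx.2.2).1 hx.1
  · rw [Prod.mk.injEq] at h
    exact Prod.ext (T.injOn_exteriorPt hx.2.1 hy.2.1 h.1) (T.injOn_exteriorPt hx.2.2 hy.2.2 h.2)

theorem finite_crossings_secondHalf (hε : ε ^ 2 = 1) :
    {x : Arrow ExteriorStrand | T.localCurves.Crosses x.1 x.2 ∧
      x.1 ∈ secondHalf ∧ x.2 ∈ secondHalf}.Finite := by
  have hfinite : Finite ExteriorStrand := Finite.of_injective _ T.exteriorIndex_injective
  refine Set.Finite.of_injOn (f := fun x => (x.1.1, x.2.1)) (mapsTo_univ _ _)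
    (fun x hx y hy h => ?_) finite_univ
  obtain ⟨htail, hhead⟩ := Prod.mk.injEq .. ▸ h
  obtain ⟨hne, hchord⟩ := T.chord_eq_of_localCurves_crosses hε hx.2.1 hx.2.2 hx.1
  obtain ⟨-, hchord'⟩ := T.chord_eq_of_localCurves_crosses hε hy.2.1 hy.2.2 hy.1
  rw [← htail, ← hhead] at hchord'
  obtain ⟨hrep, hrep'⟩ := lineMap_eq_lineMap_unique (T.planeDet_chord_ne_zero hε hne hchord)
    hchord hchord'
  exact Prod.ext (ext_rep htail (by linarith)) (ext_rep hhead (by linarith))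

theorem localCurves_finite_crossings (hε : ε ^ 2 = 1) :
    {x : Arrow ExteriorStrand | T.localCurves.Crosses x.1 x.2}.Finite :=
  ((T.finite_crossings_firstHalf hε).union (T.finite_crossings_secondHalf hε)).subset
    fun _ hx => ((T.closesExterior_localCurves hε).mem_halves_of_crosses hε hx).imp
      (And.intro hx) (And.intro hx)

/-- The preimages of crossing points on the overpassing strands of the local link: outside the
changing disk they are those of `k`, and inside the strand that closes `a` passes over the strand
that closes `b`. -/
def localOverpass : Set (Pt ExteriorStrand) :=
  {p | (∃ q, T.localCurves.Crosses p q) ∧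
    if rep 0 p ≤ 1 / 2 then T.exteriorPt p ∈ k.overpass else p.1 = .a}

theorem mem_localOverpass_of_rep_le (hp : rep 0 p ≤ 1 / 2)
    (h : ∃ q, T.localCurves.Crosses p q) :
    p ∈ T.localOverpass ↔ T.exteriorPt p ∈ k.overpass := by
  rw [localOverpass, mem_ofPred_eq, if_pos hp]
  exact and_iff_right h

theorem mem_localOverpass_of_lt_rep (hp : 1 / 2 < rep 0 p)
    (h : ∃ q, T.localCurves.Crosses p q) : p ∈ T.localOverpass ↔ p.1 = .a := by
  rw [localOverpass, mem_ofPred_eq, if_neg hp.not_ge]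
  exact and_iff_right h

theorem mem_localOverpass_iff_notMem (hε : ε ^ 2 = 1) (h : T.localCurves.Crosses p q) :
    p ∈ T.localOverpass ↔ q ∉ T.localOverpass := by
  have hT := T.closesExterior_localCurves hε
  rcases hT.mem_halves_of_crosses hε h with ⟨hp, hq⟩ | ⟨hp, hq⟩
  · rw [T.mem_localOverpass_of_rep_le hp.2.le ⟨_, h⟩,
      T.mem_localOverpass_of_rep_le hq.2.le ⟨_, h.symm⟩]
    exact k.overpass_iff _ _ ((hT.crosses_iff hp hq).1 h)
  · rw [T.mem_localOverpass_of_lt_rep hp.1 ⟨_, h⟩, T.mem_localOverpass_of_lt_rep hq.1 ⟨_, h.symm⟩]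
    have hne := (T.chord_eq_of_localCurves_crosses hε hp hq h).1
    cases hp : p.1 <;> cases hq : q.1 <;> simp_all

/-- The local link that is obtained by closing the exterior strands by chords. -/
def localLink (hε : ε ^ 2 = 1) : LinkDiagram ExteriorStrand where
  toClosedCurves := T.localCurves
  piecewise_regular c t := piecewise_regular_of_curve_eq_glue rfl (T.closing_half c)
    (T.closing_one c) (fun u _ => T.immersedAt_exterior _ u)
    (fun _ hu => T.immersedAt_closing hε c hu) t
  regular_of_crosses _ _ _ h := T.localCurves_regularAt hε h
  transversal _ _ h := T.localCurves_transversal hε h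
  no_triple _ _ _ h h' := T.localCurves_no_triple hε h h'
  finite_crossings := T.localCurves_finite_crossings hε
  overpass := T.localOverpass
  crosses_of_mem_overpass _ h := h.1
  overpass_iff _ _ h := T.mem_localOverpass_iff_notMem hε h

theorem isLocalLink_localLink (hε : ε ^ 2 = 1) : T.IsLocalLink (T.localLink hε) where
  exterior c i hi u hu := by
    obtain rfl := T.isNumberOf_iff.1 hi
    exact (T.closesExterior_localCurves hε).curve_eq c u hu
  over_exterior c i hi u hu h := by
    obtain rfl := T.isNumberOf_iff.1 hi
    have hrep : rep 0 (pt c u) = u := rep_pt c ⟨hu.1, by linarith [hu.2]⟩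
    have hover := T.mem_localOverpass_of_rep_le (hrep.trans_le hu.2) h
    rwa [exteriorPt, hrep] at hover
  closing := (T.closesExterior_localCurves hε).curve_mem_interior
  closing_not_over u hu v _ _ hover := by
    have hrep : rep 0 (pt ExteriorStrand.b u) = u :=
      rep_pt _ ⟨by linarith [hu.1], by linarith [hu.2]⟩
    have := (T.mem_localOverpass_of_lt_rep (hrep.symm ▸ hu.1) hover.1).1 hover
    cases this

end ThreeStrands

end

theorem mainTheorem6_general (k l : KnotDiagram) (C : Set Plane) (m : Omega3Move k l C) :
    (∃ L : LinkDiagram ExteriorStrand, m.before.IsLocalLink L) ∧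
      ∀ L : LinkDiagram ExteriorStrand, m.before.IsLocalLink L →
        l.weirdness - k.weirdness = m.after.q * L.linkingNumber .b .a := by
  refine ⟨⟨_, m.before.isLocalLink_localLink (one_pow 2)⟩, fun L hL => ?_⟩
  rw [m.weirdness_sub, hL.linkingNumber_eq (one_pow 2)]

theorem mainTheorem6 (k l : KnotDiagram) (C : Set Plane) (m : Omega3Move k l C)
    (hm : m.IsPositive) :
    (∃ L : LinkDiagram ExteriorStrand, m.before.IsLocalLink L) ∧
      ∀ L : LinkDiagram ExteriorStrand, m.before.IsLocalLink L →
        l.weirdness - k.weirdness = L.linkingNumber .b .a := by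
  simpa only [hm.2, one_mul] using mainTheorem6_general k l C m
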